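/- **Setting.** Let $(K,\Delta)$ be a finite nonempty metric space with $|K|=k$ and $\Delta(i,j)\le 1$ for all $i,j\in K$. For $\epsilon>0$ let $N^{\mathrm c}_\epsilon(\Delta)$ be the smallest number of closed balls of radius $\epsilon$ centred at points of $K$ that cover $K$, and let the covering complexity be $$\mathcal C_{\mathrm c}=\mathcal C_{\mathrm c}(\Delta)=\sup_{0<\epsilon<1}\epsilon\cdot N^{\mathrm c}_\epsilon(\Delta).$$ In the bandit problem with movement costs, an oblivious adversary fixes loss functions $\ell_1,\dots,\ell_T:K\to[0,1]$ before the game. In round $t=1,\dots,T$ a randomized learner, who knows $(K,\Delta)$ and $T$, plays an action $i_t\in K$ and then observes the number $\ell_t(i_t)$ and nothing else. Her movement regret is $$\mathrm{Regret}_{\mathsf{MC}}(\ell_{1:T},\Delta)=\mathbb E\Big[\sum_{t=1}^T\ell_t(i_t)+\sum_{t=2}^T\Delta(i_t,i_{t-1})\Big]-\min_{i\in K}\sum_{t=1}^T\ell_t(i),$$ the expectation being over the learner's randomization. **Theorem (Upper Bound).** There are universal constants $C>0$ and $p\in\mathbb N$ such that for every finite nonempty metric space $(K,\Delta)$ with $k$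 points and diameter at most $1$ and every horizon $T\ge 1$ there is a randomized bandit learning algorithm which, for every sequence of loss functions $\ell_1,\dots,\ell_T:K\to[0,1]$, guarantees $$\mathrm{Regret}_{\mathsf{MC}}(\ell_{1:T},\Delta)\le C\,\bigl(1+\log(kT)\bigr)^p\,\max\Bigl\{\mathcal C_{\mathrm c}^{1/3}\,T^{2/3},\ \sqrt{kT}\Bigr\}.$$ -/

import Mathlib

open scoped NNReal ENNReal

universe u

noncomputable section

/-- The covering complexity of a metric space `K`: the supremum over `0 < ε < 1` of `ε` times the
smallest number of closed balls of radius `ε`, centred at points of `K`, that cover `K`. -/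
def coveringComplexity (K : Type u) [MetricSpace K] : ℝ≥0∞ :=
  ⨆ (ε : ℝ≥0) (_ : 0 < ε) (_ : ε < 1),
    (ε : ℝ≥0∞) * ((Metric.coveringNumber ε (Set.univ : Set K) : ℕ∞) : ℝ≥0∞)

/-- On a finite metric space the covering complexity is at most the number of points, so it is
finite and its real value loses nothing. -/
theorem coveringComplexity_le_card (K : Type u) [MetricSpace K] [Fintype K] :
    coveringComplexity K ≤ (Fintype.card K : ℝ≥0∞) := by
  refine iSup_le fun ε => iSup_le fun _ => iSup_le fun h1 => ?_
  have hN : Metric.coveringNumber ε (Set.univ : Set K) ≤ (Fintype.card K : ℕ∞) := by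
    have h := Metric.coveringNumber_le_encard_self (ε := ε) (Set.univ : Set K)
    simpa using h
  have hN' : ((Metric.coveringNumber ε (Set.univ : Set K) : ℕ∞) : ℝ≥0∞)
      ≤ (Fintype.card K : ℝ≥0∞) := by
    exact_mod_cast hN
  have hε : (ε : ℝ≥0∞) ≤ 1 := by exact_mod_cast h1.le
  calc (ε : ℝ≥0∞) * ((Metric.coveringNumber ε (Set.univ : Set K) : ℕ∞) : ℝ≥0∞)
      ≤ 1 * (Fintype.card K : ℝ≥0∞) := mul_le_mul' hε hN'
    _ = (Fintype.card K : ℝ≥0∞) := one_mul _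

theorem coveringComplexity_ne_top (K : Type u) [MetricSpace K] [Fintype K] :
    coveringComplexity K ≠ ⊤ :=
  ne_top_of_le_ne_top (ENNReal.natCast_ne_top _) (coveringComplexity_le_card K)

/-- A randomized online learner with bandit feedback over the set of actions `K`. In every round
it draws an action from a distribution determined by its memory; then it observes one real number
(the loss of the action it has just played) and nothing else, and updates its memory, possibly at
random. The memory may hold the whole past (round counter, actions, observed losses, random
bits). -/
structure BanditAlgorithm (K : Type u) where
  /-- the possible contents of the memory -/
  Memory : Type u
  /-- law of the memory before the first round -/
  init : PMF Memory
  /-- law of the action, given the memory -/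
  choose : Memory → PMF K
  /-- law of the new memory, given the old one, the played action and the observed loss -/
  update : Memory → K → ℝ → PMF Memory

namespace BanditAlgorithm

variable {K : Type u}

/-- The joint law of the first `T` actions and of the memory after `T` rounds, when the learner
plays against the fixed loss functions `ℓ 0, ℓ 1, …` (round number `t + 1` has loss `ℓ t`). -/
def play (A : BanditAlgorithm K) (ℓ : ℕ → K → ℝ) : (T : ℕ) → PMF ((Fin T → K) × A.Memory)
  | 0 => A.init.map fun m => (Fin.elim0, m)
  | T + 1 =>
    (A.play ℓ T).bind fun s =>
      (A.choose s.2).bind fun i =>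
        (A.update s.2 i (ℓ T i)).map fun m => (Fin.snoc s.1 i, m)

/-- The law of the actions played in the first `T` rounds. -/
def actionLaw (A : BanditAlgorithm K) (ℓ : ℕ → K → ℝ) (T : ℕ) : PMF (Fin T → K) :=
  (A.play ℓ T).map Prod.fst

end BanditAlgorithm

/-- Total movement along a sequence of `T` actions: the sum of the distances of consecutive
actions. The first action is free. -/
def movementCost {K : Type u} [MetricSpace K] : {T : ℕ} → (Fin T → K) → ℝ
  | 0, _ => 0
  | T + 1, i => ∑ t : Fin T, dist (i t.succ) (i t.castSucc)

/-- Total cost of a sequence of `T` actions: losses plus movement. -/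
def totalCost {K : Type u} [MetricSpace K] (ℓ : ℕ → K → ℝ) {T : ℕ} (i : Fin T → K) : ℝ :=
  (∑ t : Fin T, ℓ t (i t)) + movementCost i

/-- Expected movement regret over `T` rounds: the expected total cost of the learner (a finite sum
over all sequences of `T` actions) minus the loss of the best fixed action in hindsight. -/
def movementRegret {K : Type u} [MetricSpace K] [Fintype K] (A : BanditAlgorithm K)
    (ℓ : ℕ → K → ℝ) (T : ℕ) : ℝ :=
  (∑ i : Fin T → K, (A.actionLaw ℓ T i).toReal * totalCost ℓ i)
    - ⨅ i : K, ∑ t ∈ Finset.range T, ℓ t i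

end

/-! The learner combines a hierarchy of partitions `π 0, …, π H`, from singletons to a single cell,
with exponential weights that are followed lazily. Cells of level `h` have diameter of order `2 ^ (h
- H)`, and their mass may change only at multiples of `2 ^ h`. In round `t` the action is resampled
inside the cell of the previous action at level `holdLevel H t`. Long moves are therefore rare:
every scale contributes `O(T / 2 ^ H)` to the movement, so the total is `O(H T / 2 ^ H)`.

Laziness costs something in the regret. Inside a cell of level `h + 1`, a block of `2 ^ h` rounds
acts as one round of exponential weights whose experts are the child cells. The square of a block
loss is at most `2 ^ h` times the sum of the squares, so level `h` has second order term `2 ^ h`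
times that of a bandit over its cells. `block` adds these terms up over the levels by induction.

The law of the action given the past is not `p t`, but it is right on average: for each cell, the
indicator of being there divided by its current mass has expectation `1`
(`lazyExpectation_cellRatio`). Hence the importance weighted estimates are unbiased, and the
expected inverse mass of the cell played at level `h` is the number of cells.

Rounding to minimal covers gives `2 ^ h * #cells ≤ c * 2 ^ H` for `0 < h < H`, where `c` is the
covering complexity; level `0` has `k` cells. Altogether the regret is at most `log k / η + η / 2 *
(k T + H c 2 ^ H T) + 8 H T / 2 ^ H`, and `2 ^ H ≈ (T / c) ^ (1 / 3)` with `η` the inverse of the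
target maximum balances it. -/

/-! ### Sums over the cells of a partition. -/

section CellSum

variable {K : Type u} [Fintype K]

open scoped Classical in
/-- The sum of `f` over the cell `q ⁻¹' {a}` of the partition of `K` given by `q`. -/
noncomputable def cellSum (q : K → K) (f : K → ℝ) (a : K) : ℝ :=
  ∑ j with q j = a, f j

open scoped Classical in
/-- The labels of the nonempty cells of the partition given by `q`. -/
noncomputable def cells (q : K → K) : Finset K := Finset.univ.image q

theorem mem_cells (q : K → K) (i : K) : q i ∈ cells q := by
  classical
  simp [cells]

theorem exists_of_mem_cells {q : K → K} {a : K} (ha : a ∈ cells q) : ∃ i, q i = a := by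
  classical
  simpa [cells] using ha

-- A coarse cell is the disjoint union of the fine cells that `f` sends to it.
open scoped Classical in
theorem cellSum_coarsen {q q' f : K → K} (hq : ∀ i, q' i = f (q i)) (g : K → ℝ) (a : K) :
    cellSum q' g a = ∑ b ∈ cells q with f b = a, cellSum q g b := by
  unfold cellSum
  rw [← Finset.sum_fiberwise_of_maps_to (s := Finset.univ.filter fun j => q' j = a)
    (t := (cells q).filter fun b => f b = a) (g := q)]
  · refine Finset.sum_congr rfl fun b hb => Finset.sum_congr ?_ fun _ _ => rfl
    ext j
    simp only [Finset.mem_filter, Finset.mem_univ, true_and] at hb ⊢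
    constructor
    · exact fun h => h.2
    · intro h
      exact ⟨by rw [hq, h, hb.2], h⟩
  · intro j hj
    simp only [Finset.mem_filter, Finset.mem_univ, true_and] at hj ⊢
    exact ⟨mem_cells q j, by rw [← hq, hj]⟩

theorem sum_cells_cellSum (q : K → K) (g : K → ℝ) : ∑ b ∈ cells q, cellSum q g b = ∑ j, g j := by
  classical
  unfold cellSum
  exact Finset.sum_fiberwise_of_maps_to (fun j _ => mem_cells q j) g

theorem cellSum_pos {q : K → K} {g : K → ℝ} (hg : ∀ j, 0 < g j) {a : K} (ha : a ∈ cells q) :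
    0 < cellSum q g a := by
  classical
  obtain ⟨i, hi⟩ := exists_of_mem_cells ha
  exact Finset.sum_pos (fun j _ => hg j) ⟨i, by simp [hi]⟩

theorem cellSum_nonneg {q : K → K} {g : K → ℝ} (hg : ∀ j, 0 ≤ g j) (a : K) :
    0 ≤ cellSum q g a :=
  Finset.sum_nonneg fun j _ => hg j

theorem cellSum_le_cellSum {q : K → K} {g g' : K → ℝ} (hg : ∀ j, g j ≤ g' j) (a : K) :
    cellSum q g a ≤ cellSum q g' a :=
  Finset.sum_le_sum fun j _ => hg j

theorem cellSum_mul_comp (q : K → K) (g : K → ℝ) (c : K → ℝ) (a : K) :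
    cellSum q (fun j => g j * c (q j)) a = cellSum q g a * c a := by
  classical
  unfold cellSum
  rw [Finset.sum_mul]
  refine Finset.sum_congr rfl fun j hj => ?_
  simp only [(Finset.mem_filter.1 hj).2]

theorem cellSum_of_injective {q : K → K} (hq : ∀ i, q i = i) (g : K → ℝ) (a : K) :
    cellSum q g a = g a := by
  classical
  unfold cellSum
  simp [hq, Finset.sum_filter]

theorem cellSum_of_const {q : K → K} {a : K} (hq : ∀ i, q i = a) (g : K → ℝ) :
    cellSum q g a = ∑ j, g j := by
  classical
  unfold cellSum
  simp [hq]

end CellSum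

/-! ### Two-sided comparison of the average and the exponential average. -/

section ExponentialAverage

/-- Invert `1 + y + y ^ 2 / 2 ≤ exp y`: the product of the two quadratics is `1 + y ^ 4 / 4 ≥ 1`. -/
theorem exp_neg_le_quadratic {y : ℝ} (hy : 0 ≤ y) : Real.exp (-y) ≤ 1 - y + y ^ 2 / 2 := by
  have h := Real.quadratic_le_exp_of_nonneg hy
  rw [Real.exp_neg, inv_le_iff_one_le_mul₀ (Real.exp_pos y)]
  have h2 : 0 ≤ 1 - y + y ^ 2 / 2 := by nlinarith [sq_nonneg (y - 1)]
  nlinarith [mul_le_mul_of_nonneg_left h h2, sq_nonneg (y ^ 2)]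

variable {ι : Type*} {s : Finset ι} {P W W' : ι → ℝ} {κ η : ℝ}

/-- Jensen's inequality for the exponential average. -/
theorem exp_average_le (hs : s.Nonempty) (hη : 0 < η) (hκ : 0 < κ)
    (hW : ∀ b ∈ s, 0 < W b) (hW' : ∀ b ∈ s, 0 < W' b) (hP : ∀ b ∈ s, P b = κ * W b) :
    (∑ b ∈ s, P b) * ((Real.log (∑ b ∈ s, W b) - Real.log (∑ b ∈ s, W' b)) / η)
      ≤ ∑ b ∈ s, P b * ((Real.log (W b) - Real.log (W' b)) / η) := by
  have hsW : 0 < ∑ b ∈ s, W b := Finset.sum_pos hW hs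
  have hsW' : 0 < ∑ b ∈ s, W' b := Finset.sum_pos hW' hs
  -- This is `log x ≤ x - 1` at the ratio of the normalized weights `W'` and `W`; summed over `b`,
  -- the right-hand side vanishes.
  have key : ∀ b ∈ s, W b * (Real.log (∑ b ∈ s, W b) - Real.log (∑ b ∈ s, W' b)) -
      W b * (Real.log (W b) - Real.log (W' b))
      ≤ W' b * ((∑ b ∈ s, W b) / (∑ b ∈ s, W' b)) - W b := by
    intro b hb
    have h := Real.log_le_sub_one_of_pos
      (x := (W' b * ((∑ b ∈ s, W b) / (∑ b ∈ s, W' b))) / W b)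
      (div_pos (mul_pos (hW' b hb) (div_pos hsW hsW')) (hW b hb))
    rw [Real.log_div (mul_pos (hW' b hb) (div_pos hsW hsW')).ne' (hW b hb).ne',
      Real.log_mul (hW' b hb).ne' (div_pos hsW hsW').ne', Real.log_div hsW.ne' hsW'.ne'] at h
    have h2 := mul_le_mul_of_nonneg_left h (hW b hb).le
    rw [mul_sub (W b) (_ / _) 1, mul_div_cancel₀ _ (hW b hb).ne'] at h2
    linarith
  have hsum := Finset.sum_le_sum key
  rw [Finset.sum_sub_distrib, Finset.sum_sub_distrib, ← Finset.sum_mul, ← Finset.sum_mul,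
    mul_div_cancel₀ _ hsW'.ne', sub_self] at hsum
  have e1 : ∑ b ∈ s, P b = κ * ∑ b ∈ s, W b := by
    rw [Finset.mul_sum]; exact Finset.sum_congr rfl hP
  have e2 : ∑ b ∈ s, P b * ((Real.log (W b) - Real.log (W' b)) / η)
      = κ / η * ∑ b ∈ s, W b * (Real.log (W b) - Real.log (W' b)) := by
    rw [Finset.mul_sum]
    refine Finset.sum_congr rfl fun b hb => ?_
    rw [hP b hb]; ring
  rw [e1, e2]
  have := mul_le_mul_of_nonneg_left (sub_nonpos.1 hsum) (div_pos hκ hη).le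
  calc _ = κ / η * ((∑ b ∈ s, W b) * (Real.log (∑ b ∈ s, W b) - Real.log (∑ b ∈ s, W' b))) := by
        ring
    _ ≤ _ := this

/-- Up to a second order term, the exponential average is at least the average. -/
theorem average_le_exp_average (hs : s.Nonempty) (hη : 0 < η) (hκ : 0 < κ)
    (hW : ∀ b ∈ s, 0 < W b) (hW' : ∀ b ∈ s, 0 < W' b) (hP : ∀ b ∈ s, P b = κ * W b)
    (hle : ∀ b ∈ s, W' b ≤ W b) :
    ∑ b ∈ s, P b * ((Real.log (W b) - Real.log (W' b)) / η) ≤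
      (∑ b ∈ s, P b) * ((Real.log (∑ b ∈ s, W b) - Real.log (∑ b ∈ s, W' b)) / η)
        + η / 2 * ∑ b ∈ s, P b * ((Real.log (W b) - Real.log (W' b)) / η) ^ 2 := by
  have hsW : 0 < ∑ b ∈ s, W b := Finset.sum_pos hW hs
  have hsW' : 0 < ∑ b ∈ s, W' b := Finset.sum_pos hW' hs
  have key : ∀ b ∈ s, W' b ≤ W b - W b * (Real.log (W b) - Real.log (W' b))
      + W b * (Real.log (W b) - Real.log (W' b)) ^ 2 / 2 := by
    intro b hb
    have hy : 0 ≤ Real.log (W b) - Real.log (W' b) :=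
      sub_nonneg.2 (Real.log_le_log (hW' b hb) (hle b hb))
    have h := exp_neg_le_quadratic hy
    rw [neg_sub, Real.exp_sub, Real.exp_log (hW b hb), Real.exp_log (hW' b hb),
      div_le_iff₀ (hW b hb)] at h
    linarith
  have hsum := Finset.sum_le_sum key
  rw [Finset.sum_add_distrib, Finset.sum_sub_distrib, ← Finset.sum_div] at hsum
  have hlog := Real.log_le_sub_one_of_pos (div_pos hsW' hsW)
  rw [Real.log_div hsW'.ne' hsW.ne'] at hlog
  have hlog2 := mul_le_mul_of_nonneg_left hlog hsW.le
  rw [mul_sub (∑ b ∈ s, W b) (_ / _) 1, mul_div_cancel₀ _ hsW.ne'] at hlog2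
  have e1 : ∑ b ∈ s, P b = κ * ∑ b ∈ s, W b := by
    rw [Finset.mul_sum]; exact Finset.sum_congr rfl hP
  have e2 : ∑ b ∈ s, P b * ((Real.log (W b) - Real.log (W' b)) / η)
      = κ / η * ∑ b ∈ s, W b * (Real.log (W b) - Real.log (W' b)) := by
    rw [Finset.mul_sum]
    refine Finset.sum_congr rfl fun b hb => ?_
    rw [hP b hb]; ring
  have e3 : η / 2 * ∑ b ∈ s, P b * ((Real.log (W b) - Real.log (W' b)) / η) ^ 2
      = κ / η * ((∑ b ∈ s, W b * (Real.log (W b) - Real.log (W' b)) ^ 2) / 2) := by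
    rw [Finset.mul_sum, Finset.sum_div, Finset.mul_sum]
    refine Finset.sum_congr rfl fun b hb => ?_
    rw [hP b hb]; field_simp
  rw [e1, e2, e3]
  have hfin : ∑ b ∈ s, W b * (Real.log (W b) - Real.log (W' b)) ≤
      (∑ b ∈ s, W b) * (Real.log (∑ b ∈ s, W b) - Real.log (∑ b ∈ s, W' b))
        + (∑ b ∈ s, W b * (Real.log (W b) - Real.log (W' b)) ^ 2) / 2 := by
    linarith
  have := mul_le_mul_of_nonneg_left hfin (div_pos hκ hη).le
  calc _ ≤ _ := this
    _ = _ := by ring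

end ExponentialAverage

/-! ### Pathwise regret of lazy exponential weights. -/

section LazyWeights

variable {K : Type u} [Fintype K]

/-- The second order term of the distribution `p` and the losses `g` with respect to the partition
given by `q`: the square of the mean of `g` over the cell, spread over the points of the cell. -/
noncomputable def secondOrder (q : K → K) (p g : K → ℝ) (j : K) : ℝ :=
  p j * (cellSum q (fun i => p i * g i) (q j) / cellSum q p (q j)) ^ 2

theorem cellSum_secondOrder (q : K → K) (p g : K → ℝ) (a : K) :
    cellSum q (secondOrder q p g) a
      = cellSum q p a * (cellSum q (fun i => p i * g i) a / cellSum q p a) ^ 2 :=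
  cellSum_mul_comp q p (fun b => (cellSum q (fun i => p i * g i) b / cellSum q p b) ^ 2) a

/-- Exponential weights `w` for the losses `g`, and distributions `p` that follow them lazily along
the partitions `π 0, π 1, …, π H`: the mass of a cell of `π h` changes only at multiples of `2 ^ h`,
and at these times `p` is proportional to `w` inside every cell of `π (h + 1)`. -/
structure IsLazyWeights (π : ℕ → K → K) (H : ℕ) (η : ℝ) (p w g : ℕ → K → ℝ) : Prop where
  p_pos : ∀ t j, 0 < p t j
  w_pos : ∀ t j, 0 < w t j
  g_nonneg : ∀ t j, 0 ≤ g t j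
  w_succ : ∀ t j, w (t + 1) j = w t j * Real.exp (-(η * g t j))
  proportional : ∀ t h, h < H → 2 ^ h ∣ t → ∀ i j, π (h + 1) i = π (h + 1) j →
    p t i * w t j = p t j * w t i
  keep : ∀ t h, h ≤ H → (h = H ∨ ¬ 2 ^ h ∣ t + 1) → ∀ a,
    cellSum (π h) (p (t + 1)) a = cellSum (π h) (p t) a

namespace IsLazyWeights

variable {π f : ℕ → K → K} {H : ℕ} {η : ℝ} {p w g : ℕ → K → ℝ}

theorem cellSum_eq (L : IsLazyWeights π H η p w g) {h s t : ℕ} (hh : h ≤ H) (hs : 2 ^ h ∣ s)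
    (ht : t ∈ Finset.Ico s (s + 2 ^ h)) (a : K) :
    cellSum (π h) (p t) a = cellSum (π h) (p s) a := by
  rw [Finset.mem_Ico] at ht
  obtain ⟨n, rfl⟩ := Nat.exists_eq_add_of_le ht.1
  have hn : n < 2 ^ h := by omega
  clear ht
  induction n with
  | zero => rfl
  | succ n ih =>
    rw [← ih (by omega), ← add_assoc]
    refine L.keep _ h hh (Or.inr fun hd => ?_) a
    have hd' : 2 ^ h ∣ n + 1 := (Nat.dvd_add_right hs).1 (by rwa [← add_assoc])
    exact absurd (Nat.le_of_dvd (Nat.succ_pos n) hd') (by omega)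

theorem cellSum_eq_of_const (L : IsLazyWeights π H η p w g) (t : ℕ) (a : K) :
    cellSum (π H) (p t) a = cellSum (π H) (p 0) a := by
  induction t with
  | zero => rfl
  | succ t ih => rw [L.keep t H le_rfl (Or.inl rfl), ih]

theorem exists_proportional (L : IsLazyWeights π H η p w g)
    (hπ : ∀ h i, π (h + 1) i = f h (π h i)) {h t : ℕ} (hh : h < H) (ht : 2 ^ h ∣ t) {a : K}
    (ha : a ∈ cells (π (h + 1))) :
    ∃ κ : ℝ, 0 < κ ∧ ∀ b, f h b = a → cellSum (π h) (p t) b = κ * cellSum (π h) (w t) b := by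
  classical
  obtain ⟨i, hi⟩ := exists_of_mem_cells ha
  refine ⟨p t i / w t i, div_pos (L.p_pos t i) (L.w_pos t i), fun b hb => ?_⟩
  unfold cellSum
  rw [Finset.mul_sum]
  refine Finset.sum_congr rfl fun j hj => ?_
  have hj' : π h j = b := (Finset.mem_filter.1 hj).2
  have h1 := L.proportional t h hh ht i j (by rw [hi, hπ h j, hj', hb])
  have := (L.w_pos t i).ne'
  field_simp
  linarith

theorem w_antitone (L : IsLazyWeights π H η p w g) (hη : 0 < η) (j : K) :
    Antitone fun t => w t j := by
  refine antitone_nat_of_succ_le fun t => ?_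
  rw [L.w_succ]
  refine mul_le_of_le_one_right (L.w_pos t j).le (Real.exp_le_one_iff.2 ?_)
  have := mul_nonneg hη.le (L.g_nonneg t j)
  linarith

/-- The exponential average of the losses of a cell during the rounds `s ≤ t < s'`. -/
noncomputable def potential (q : K → K) (η : ℝ) (w : ℕ → K → ℝ) (s s' : ℕ) (a : K) : ℝ :=
  (Real.log (cellSum q (w s) a) - Real.log (cellSum q (w s') a)) / η

/-- Passes from level `h` to level `h + 1` on a block of `2 ^ h` rounds. At its start the child
masses are proportional to their weights, so the exponential average over the parent is that of the
potentials of the children. Jensen gives the lower bound; the upper bound pays one new second order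
term, for level `h`. -/
theorem half_block (L : IsLazyWeights π H η p w g) (hη : 0 < η)
    (hπ : ∀ h i, π (h + 1) i = f h (π h i)) {h s : ℕ} (hh : h < H) (hs : 2 ^ h ∣ s)
    (ih : ∀ b ∈ cells (π h),
      cellSum (π h) (p s) b * potential (π h) η w s (s + 2 ^ h) b
        ≤ ∑ t ∈ Finset.Ico s (s + 2 ^ h), cellSum (π h) (fun j => p t j * g t j) b ∧
      ∑ t ∈ Finset.Ico s (s + 2 ^ h), cellSum (π h) (fun j => p t j * g t j) b
        ≤ cellSum (π h) (p s) b * potential (π h) η w s (s + 2 ^ h) b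
          + η / 2 * ∑ h' ∈ Finset.range h, 2 ^ h' * ∑ t ∈ Finset.Ico s (s + 2 ^ h),
              cellSum (π h) (secondOrder (π h') (p t) (g t)) b)
    {a : K} (ha : a ∈ cells (π (h + 1))) :
    cellSum (π (h + 1)) (p s) a * potential (π (h + 1)) η w s (s + 2 ^ h) a
        ≤ ∑ t ∈ Finset.Ico s (s + 2 ^ h), cellSum (π (h + 1)) (fun j => p t j * g t j) a ∧
      ∑ t ∈ Finset.Ico s (s + 2 ^ h), cellSum (π (h + 1)) (fun j => p t j * g t j) a
        ≤ cellSum (π (h + 1)) (p s) a * potential (π (h + 1)) η w s (s + 2 ^ h) a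
          + η / 2 * ∑ h' ∈ Finset.range (h + 1), 2 ^ h' * ∑ t ∈ Finset.Ico s (s + 2 ^ h),
              cellSum (π (h + 1)) (secondOrder (π h') (p t) (g t)) a := by
  classical
  obtain ⟨κ, hκ, hprop⟩ := L.exists_proportional hπ hh hs ha
  have hco := fun u => cellSum_coarsen (hπ h) u a
  set S := (cells (π h)).filter fun b => f h b = a with hS
  have hmem : ∀ b ∈ S, b ∈ cells (π h) := fun b hb => (Finset.mem_filter.1 hb).1
  have hSne : S.Nonempty := by
    obtain ⟨i, hi⟩ := exists_of_mem_cells ha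
    exact ⟨π h i, Finset.mem_filter.2 ⟨mem_cells _ i, by rw [← hπ, hi]⟩⟩
  have hW : ∀ b ∈ S, 0 < cellSum (π h) (w s) b := fun b hb => cellSum_pos (L.w_pos s) (hmem b hb)
  have hW' : ∀ b ∈ S, 0 < cellSum (π h) (w (s + 2 ^ h)) b :=
    fun b hb => cellSum_pos (L.w_pos _) (hmem b hb)
  have hP : ∀ b ∈ S, cellSum (π h) (p s) b = κ * cellSum (π h) (w s) b :=
    fun b hb => hprop b (Finset.mem_filter.1 hb).2
  have hle : ∀ b ∈ S, cellSum (π h) (w (s + 2 ^ h)) b ≤ cellSum (π h) (w s) b := fun b _ =>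
    cellSum_le_cellSum (fun j => L.w_antitone hη j (Nat.le_add_right s _)) b
  have hJ := exp_average_le hSne hη hκ hW hW' hP
  have hQ := average_le_exp_average hSne hη hκ hW hW' hP hle
  rw [← hco, ← hco, ← hco] at hJ hQ
  have hm : ∑ t ∈ Finset.Ico s (s + 2 ^ h), cellSum (π (h + 1)) (fun j => p t j * g t j) a
      = ∑ b ∈ S, ∑ t ∈ Finset.Ico s (s + 2 ^ h), cellSum (π h) (fun j => p t j * g t j) b := by
    rw [Finset.sum_comm]
    exact Finset.sum_congr rfl fun t _ => hco _
  -- The lower bound in `ih` controls the potential by the sum of the cell means, and Cauchy-Schwarz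
  -- over the `2 ^ h` rounds produces the factor `2 ^ h`.
  have hnew : ∀ b ∈ S, cellSum (π h) (p s) b * potential (π h) η w s (s + 2 ^ h) b ^ 2 ≤
      2 ^ h * ∑ t ∈ Finset.Ico s (s + 2 ^ h),
        cellSum (π h) (secondOrder (π h) (p t) (g t)) b := by
    intro b hb
    have hPb : 0 < cellSum (π h) (p s) b := cellSum_pos (L.p_pos s) (hmem b hb)
    have hpot : 0 ≤ potential (π h) η w s (s + 2 ^ h) b :=
      div_nonneg (sub_nonneg.2 (Real.log_le_log (hW' b hb) (hle b hb))) hη.le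
    have h1 : potential (π h) η w s (s + 2 ^ h) b ≤ ∑ t ∈ Finset.Ico s (s + 2 ^ h),
        cellSum (π h) (fun j => p t j * g t j) b / cellSum (π h) (p t) b := by
      have e : ∑ t ∈ Finset.Ico s (s + 2 ^ h),
          cellSum (π h) (fun j => p t j * g t j) b / cellSum (π h) (p t) b
          = (∑ t ∈ Finset.Ico s (s + 2 ^ h), cellSum (π h) (fun j => p t j * g t j) b)
            / cellSum (π h) (p s) b := by
        rw [Finset.sum_div]
        exact Finset.sum_congr rfl fun t ht => by rw [L.cellSum_eq hh.le hs ht]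
      rw [e, le_div_iff₀ hPb, mul_comm]
      exact (ih b (hmem b hb)).1
    have h2 := pow_le_pow_left₀ hpot h1 2
    have h3 := sq_sum_le_card_mul_sum_sq (s := Finset.Ico s (s + 2 ^ h))
      (f := fun t => cellSum (π h) (fun j => p t j * g t j) b / cellSum (π h) (p t) b)
    rw [Nat.card_Ico, Nat.add_sub_cancel_left] at h3
    push_cast at h3
    have h4 := mul_le_mul_of_nonneg_left (h2.trans h3) hPb.le
    refine h4.trans_eq ?_
    rw [mul_left_comm, Finset.mul_sum]
    congr 1
    refine Finset.sum_congr rfl fun t ht => ?_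
    rw [cellSum_secondOrder, L.cellSum_eq hh.le hs ht]
  rw [hm]
  constructor
  · exact hJ.trans (Finset.sum_le_sum fun b hb => (ih b (hmem b hb)).1)
  · refine (Finset.sum_le_sum fun b hb => (ih b (hmem b hb)).2).trans ?_
    rw [Finset.sum_add_distrib, ← Finset.mul_sum, Finset.sum_range_succ]
    have hold : ∑ b ∈ S, ∑ h' ∈ Finset.range h, 2 ^ h' * ∑ t ∈ Finset.Ico s (s + 2 ^ h),
          cellSum (π h) (secondOrder (π h') (p t) (g t)) b
        = ∑ h' ∈ Finset.range h, 2 ^ h' * ∑ t ∈ Finset.Ico s (s + 2 ^ h),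
          cellSum (π (h + 1)) (secondOrder (π h') (p t) (g t)) a := by
      rw [Finset.sum_comm]
      refine Finset.sum_congr rfl fun h' _ => ?_
      rw [← Finset.mul_sum, Finset.sum_comm]
      congr 1
      exact Finset.sum_congr rfl fun t _ => (hco _).symm
    have hnew' : ∑ b ∈ S, cellSum (π h) (p s) b * potential (π h) η w s (s + 2 ^ h) b ^ 2 ≤
        2 ^ h * ∑ t ∈ Finset.Ico s (s + 2 ^ h),
          cellSum (π (h + 1)) (secondOrder (π h) (p t) (g t)) a := by
      refine (Finset.sum_le_sum hnew).trans_eq ?_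
      rw [← Finset.mul_sum, Finset.sum_comm]
      congr 1
      exact Finset.sum_congr rfl fun t _ => (hco _).symm
    rw [hold]
    have := mul_le_mul_of_nonneg_left hnew' (half_pos hη).le
    unfold potential at this ⊢
    linarith

/-- The lower bound is carried along because the upper bound one level higher needs it to control
squares of potentials. -/
theorem block (L : IsLazyWeights π H η p w g) (hη : 0 < η)
    (hπ : ∀ h i, π (h + 1) i = f h (π h i)) (hπ0 : ∀ i, π 0 i = i) {h : ℕ} (hh : h ≤ H) :
    ∀ s, 2 ^ h ∣ s → ∀ a ∈ cells (π h),
      cellSum (π h) (p s) a * potential (π h) η w s (s + 2 ^ h) a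
        ≤ ∑ t ∈ Finset.Ico s (s + 2 ^ h), cellSum (π h) (fun j => p t j * g t j) a ∧
      ∑ t ∈ Finset.Ico s (s + 2 ^ h), cellSum (π h) (fun j => p t j * g t j) a
        ≤ cellSum (π h) (p s) a * potential (π h) η w s (s + 2 ^ h) a
          + η / 2 * ∑ h' ∈ Finset.range h, 2 ^ h' * ∑ t ∈ Finset.Ico s (s + 2 ^ h),
              cellSum (π h) (secondOrder (π h') (p t) (g t)) a := by
  induction h with
  | zero =>
    intro s _ a _
    -- On a singleton and a single round the exponential average is the loss itself.
    have e : potential (π 0) η w s (s + 2 ^ 0) a = g s a := by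
      unfold potential
      rw [cellSum_of_injective hπ0, cellSum_of_injective hπ0, pow_zero, L.w_succ,
        Real.log_mul (L.w_pos s a).ne' (Real.exp_pos _).ne', Real.log_exp]
      field_simp
      ring
    rw [e]
    simp [cellSum_of_injective hπ0]
  | succ h ih =>
    intro s hs a ha
    have hs0 : 2 ^ h ∣ s := (pow_dvd_pow 2 (Nat.le_succ h)).trans hs
    have hs1 : 2 ^ h ∣ s + 2 ^ h := (Nat.dvd_add_right hs0).2 dvd_rfl
    have B0 := L.half_block hη hπ hh hs0 (ih (by omega) s hs0) ha
    have B1 := L.half_block hη hπ hh hs1 (ih (by omega) _ hs1) ha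
    have e2 : s + 2 ^ (h + 1) = s + 2 ^ h + 2 ^ h := by rw [pow_succ]; ring
    -- The parent mass is frozen over both half blocks, so their potentials telescope with the same
    -- factor.
    have hmass : cellSum (π (h + 1)) (p (s + 2 ^ h)) a = cellSum (π (h + 1)) (p s) a := by
      refine L.cellSum_eq hh hs (Finset.mem_Ico.2 ⟨Nat.le_add_right _ _, ?_⟩) a
      have := Nat.two_pow_pos h
      omega
    have hpot : potential (π (h + 1)) η w s (s + 2 ^ (h + 1)) a
        = potential (π (h + 1)) η w s (s + 2 ^ h) a
          + potential (π (h + 1)) η w (s + 2 ^ h) (s + 2 ^ h + 2 ^ h) a := by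
      unfold potential
      rw [e2]; ring
    have hsplit : ∀ F : ℕ → ℝ, ∑ t ∈ Finset.Ico s (s + 2 ^ (h + 1)), F t
        = ∑ t ∈ Finset.Ico s (s + 2 ^ h), F t
          + ∑ t ∈ Finset.Ico (s + 2 ^ h) (s + 2 ^ h + 2 ^ h), F t := by
      intro F
      rw [e2, Finset.sum_Ico_consecutive F (Nat.le_add_right _ _) (Nat.le_add_right _ _)]
    rw [hmass] at B1
    rw [hpot, hsplit]
    simp only [hsplit, mul_add, Finset.sum_add_distrib] at B0 B1 ⊢
    constructor <;> linarith [B0.1, B0.2, B1.1, B1.2]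

/-- The regret of lazy exponential weights against a fixed point, for a fixed loss sequence. -/
theorem regret_le (L : IsLazyWeights π H η p w g) (hη : 0 < η)
    (hπ : ∀ h i, π (h + 1) i = f h (π h i)) (hπ0 : ∀ i, π 0 i = i)
    (hconst : ∀ i j, π H i = π H j) (hp1 : ∑ j, p 0 j = 1) (hw1 : ∀ j, w 0 j = 1)
    (n : ℕ) (i : K) :
    ∑ t ∈ Finset.range (n * 2 ^ H), ∑ j, p t j * g t j
      ≤ ∑ t ∈ Finset.range (n * 2 ^ H), g t i + Real.log (Fintype.card K) / η
        + η / 2 * ∑ h ∈ Finset.range H, 2 ^ h * ∑ t ∈ Finset.range (n * 2 ^ H),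
          ∑ j, secondOrder (π h) (p t) (g t) j := by
  have hc : ∀ g : K → ℝ, cellSum (π H) g (π H i) = ∑ j, g j :=
    fun g => cellSum_of_const (fun j => hconst j i) g
  have hp : ∀ t, ∑ j, p t j = 1 := fun t => by
    rw [← hc, L.cellSum_eq_of_const, hc, hp1]
  have main : ∀ n : ℕ, ∑ t ∈ Finset.range (n * 2 ^ H), ∑ j, p t j * g t j
      ≤ potential (π H) η w 0 (n * 2 ^ H) (π H i)
        + η / 2 * ∑ h ∈ Finset.range H, 2 ^ h * ∑ t ∈ Finset.range (n * 2 ^ H),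
          ∑ j, secondOrder (π h) (p t) (g t) j := by
    intro n
    induction n with
    | zero => simp [potential]
    | succ n ih =>
      have B := (L.block hη hπ hπ0 le_rfl (n * 2 ^ H) (dvd_mul_left _ _) (π H i)
        (mem_cells _ i)).2
      simp only [hc, hp, one_mul] at B
      have hsplit : ∀ F : ℕ → ℝ, ∑ t ∈ Finset.range ((n + 1) * 2 ^ H), F t
          = ∑ t ∈ Finset.range (n * 2 ^ H), F t
            + ∑ t ∈ Finset.Ico (n * 2 ^ H) (n * 2 ^ H + 2 ^ H), F t := by
        intro F
        rw [Finset.sum_range_add_sum_Ico _ (Nat.le_add_right _ _), add_one_mul]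
      have hpot : potential (π H) η w 0 ((n + 1) * 2 ^ H) (π H i)
          = potential (π H) η w 0 (n * 2 ^ H) (π H i)
            + potential (π H) η w (n * 2 ^ H) (n * 2 ^ H + 2 ^ H) (π H i) := by
        unfold potential
        rw [add_one_mul]; ring
      rw [hpot]
      simp only [hsplit, mul_add, Finset.sum_add_distrib]
      linarith
  have hlogw : ∀ t, Real.log (w t i) = -(η * ∑ s ∈ Finset.range t, g s i) := by
    intro t
    induction t with
    | zero => simp [hw1]
    | succ t ih =>
      rw [L.w_succ, Real.log_mul (L.w_pos t i).ne' (Real.exp_pos _).ne', Real.log_exp, ih,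
        Finset.sum_range_succ]
      ring
  have hpot : potential (π H) η w 0 (n * 2 ^ H) (π H i)
      ≤ ∑ t ∈ Finset.range (n * 2 ^ H), g t i + Real.log (Fintype.card K) / η := by
    unfold potential
    rw [hc, hc]
    have h1 : ∑ j, w 0 j = Fintype.card K := by simp [hw1]
    -- The final total weight is at least the weight of the competitor `i`.
    have h2 : Real.log (w (n * 2 ^ H) i) ≤ Real.log (∑ j, w (n * 2 ^ H) j) :=
      Real.log_le_log (L.w_pos _ i)
        (Finset.single_le_sum (f := fun j => w (n * 2 ^ H) j) (fun j _ => (L.w_pos _ j).le)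
          (Finset.mem_univ i))
    rw [h1, div_le_iff₀ hη, add_mul, div_mul_cancel₀ _ hη.ne']
    rw [hlogw] at h2
    linarith
  linarith [main n]

end IsLazyWeights

end LazyWeights

/-! ### Finite expectations and infinite extensions of action sequences. -/

section FiniteExpectation

variable {α β : Type*} [Fintype α] [Fintype β]

theorem PMF.sum_toReal_eq_one (μ : PMF α) : ∑ a, (μ a).toReal = 1 := by
  have h := μ.tsum_coe
  rw [tsum_fintype] at h
  rw [← ENNReal.toReal_sum fun a _ => μ.apply_ne_top a, h, ENNReal.toReal_one]

theorem PMF.sum_bind_toReal_mul (μ : PMF α) (ν : α → PMF β) (F : β → ℝ) :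
    ∑ b, (μ.bind ν b).toReal * F b = ∑ a, (μ a).toReal * ∑ b, (ν a b).toReal * F b := by
  simp_rw [PMF.bind_apply, tsum_fintype, Finset.mul_sum]
  rw [Finset.sum_comm]
  refine Finset.sum_congr rfl fun b _ => ?_
  rw [ENNReal.toReal_sum fun a _ => ENNReal.mul_ne_top (μ.apply_ne_top a) ((ν a).apply_ne_top b),
    Finset.sum_mul]
  exact Finset.sum_congr rfl fun a _ => by rw [ENNReal.toReal_mul, mul_assoc]

theorem PMF.sum_map_toReal_mul (μ : PMF α) (f : α → β) (F : β → ℝ) :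
    ∑ b, (μ.map f b).toReal * F b = ∑ a, (μ a).toReal * F (f a) := by
  classical
  rw [← PMF.bind_pure_comp, PMF.sum_bind_toReal_mul]
  refine Finset.sum_congr rfl fun a _ => ?_
  congr 1
  simp [PMF.pure_apply, apply_ite ENNReal.toReal]

end FiniteExpectation

section Extension

variable {K : Type u}

/-- The infinite sequence that continues a finite one by the constant `i₀`. -/
def extendPath (i₀ : K) {T : ℕ} (i : Fin T → K) (t : ℕ) : K :=
  if h : t < T then i ⟨t, h⟩ else i₀

theorem extendPath_snoc (i₀ : K) {T : ℕ} (i : Fin T → K) (j : K) :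
    extendPath i₀ (Fin.snoc i j : Fin (T + 1) → K) = Function.update (extendPath i₀ i) T j := by
  funext t
  rcases lt_trichotomy t T with h | rfl | h
  · simp [extendPath, h, h.ne, h.trans (Nat.lt_succ_self T), Fin.snoc]
  · simp [extendPath, Fin.snoc]
  · simp [extendPath, h.ne', not_lt.2 h.le, not_lt.2 (Nat.succ_le_of_lt h)]

theorem extendPath_apply (i₀ : K) {T : ℕ} (i : Fin T → K) (t : Fin T) :
    extendPath i₀ i t = i t := by
  simp [extendPath]

theorem totalCost_eq [MetricSpace K] (i₀ : K) (ℓ : ℕ → K → ℝ) {T : ℕ} (i : Fin T → K) :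
    totalCost ℓ i = ∑ t ∈ Finset.range T, ℓ t (extendPath i₀ i t)
      + ∑ t ∈ Finset.range (T - 1), dist (extendPath i₀ i (t + 1)) (extendPath i₀ i t) := by
  unfold totalCost
  congr 1
  · rw [Finset.sum_range]
    exact Finset.sum_congr rfl fun t _ => by rw [extendPath_apply]
  · cases T with
    | zero => simp [movementCost]
    | succ T =>
      rw [Nat.add_sub_cancel, Finset.sum_range]
      unfold movementCost
      refine Finset.sum_congr rfl fun t _ => ?_
      rw [← extendPath_apply i₀ i t.succ, ← extendPath_apply i₀ i t.castSucc]
      rfl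

end Extension

theorem BanditAlgorithm.play_congr {K : Type u} (A : BanditAlgorithm K) {ℓ ℓ' : ℕ → K → ℝ} {T : ℕ}
    (h : ∀ t < T, ℓ t = ℓ' t) : A.play ℓ T = A.play ℓ' T := by
  induction T with
  | zero => rfl
  | succ T ih =>
    simp only [BanditAlgorithm.play]
    rw [ih fun t ht => h t (by omega), h T (Nat.lt_succ_self T)]

theorem movementRegret_congr {K : Type u} [MetricSpace K] [Fintype K] (A : BanditAlgorithm K)
    {ℓ ℓ' : ℕ → K → ℝ} {T : ℕ} (h : ∀ t < T, ℓ t = ℓ' t) :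
    movementRegret A ℓ T = movementRegret A ℓ' T := by
  have h1 : ∀ i : Fin T → K, totalCost ℓ i = totalCost ℓ' i := fun i => by
    unfold totalCost
    congr 1
    exact Finset.sum_congr rfl fun t _ => by rw [h t t.2]
  have h2 : ∀ i : K, ∑ t ∈ Finset.range T, ℓ t i = ∑ t ∈ Finset.range T, ℓ' t i := fun i =>
    Finset.sum_congr rfl fun t ht => by rw [h t (Finset.mem_range.1 ht)]
  unfold movementRegret BanditAlgorithm.actionLaw
  simp only [A.play_congr h, h1, h2]

/-! ### Redistribution of mass inside cells, conditional laws and loss estimates. -/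

section Refresh

variable {K : Type u} [Fintype K]

/-- The distribution that gives the cells of the partition `q` the same mass as `p` and is
proportional to `w` inside each cell. -/
noncomputable def refresh (q : K → K) (p w : K → ℝ) (j : K) : ℝ :=
  w j * (cellSum q p (q j) / cellSum q w (q j))

theorem refresh_pos {q : K → K} {p w : K → ℝ} (hp : ∀ j, 0 < p j) (hw : ∀ j, 0 < w j) (j : K) :
    0 < refresh q p w j :=
  mul_pos (hw j) (div_pos (cellSum_pos hp (mem_cells q j)) (cellSum_pos hw (mem_cells q j)))

theorem cellSum_refresh {q q' f : K → K} (hq : ∀ i, q' i = f (q i)) {p w : K → ℝ}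
    (hw : ∀ j, 0 < w j) (a : K) : cellSum q' (refresh q p w) a = cellSum q' p a := by
  classical
  rw [cellSum_coarsen hq, cellSum_coarsen hq]
  refine Finset.sum_congr rfl fun b hb => ?_
  have hW := cellSum_pos hw (Finset.mem_filter.1 hb).1
  have := cellSum_mul_comp q w (fun b => cellSum q p b / cellSum q w b) b
  rw [mul_div_cancel₀ _ hW.ne'] at this
  exact this

open scoped Classical in
/-- The law of `p` conditioned on the cell of the point `l`. -/
noncomputable def cellLaw (q : K → K) (p : K → ℝ) (l j : K) : ℝ :=
  if q j = q l then p j / cellSum q p (q l) else 0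

theorem cellLaw_nonneg {q : K → K} {p : K → ℝ} (hp : ∀ j, 0 < p j) (l j : K) :
    0 ≤ cellLaw q p l j := by
  unfold cellLaw
  split_ifs
  · exact div_nonneg (hp j).le (cellSum_nonneg (fun j => (hp j).le) _)
  · exact le_rfl

theorem sum_cellLaw {q : K → K} {p : K → ℝ} (hp : ∀ j, 0 < p j) (l : K) :
    ∑ j, cellLaw q p l j = 1 := by
  classical
  unfold cellLaw
  rw [← Finset.sum_filter, ← Finset.sum_div]
  exact div_self (cellSum_pos hp (mem_cells q l)).ne'

/-- The indicator of the cell of `i`, divided by the mass of the cell. -/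
noncomputable def cellRatio (q : K → K) (p : K → ℝ) (i j : K) : ℝ :=
  open scoped Classical in if q j = q i then (cellSum q p (q i))⁻¹ else 0

/-- Conditioned on a coarse cell, the fine cell has probability its mass over the coarse mass, so
the fine mass cancels and the ratio of the coarse cell remains. -/
theorem sum_cellLaw_mul_cellRatio_of_finer {q q' f : K → K} (hq : ∀ i, q' i = f (q i)) {p : K → ℝ}
    (hp : ∀ j, 0 < p j) (l i : K) :
    ∑ j, cellLaw q' p l j * cellRatio q p i j = cellRatio q' p i l := by
  classical
  unfold cellLaw cellRatio
  by_cases h : q' l = q' i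
  · rw [if_pos h]
    have h0 := (cellSum_pos hp (mem_cells q i)).ne'
    have : ∀ j, ((if q' j = q' l then p j / cellSum q' p (q' l) else 0) *
        if q j = q i then (cellSum q p (q i))⁻¹ else 0)
        = if q j = q i then p j * ((cellSum q p (q i))⁻¹ * (cellSum q' p (q' i))⁻¹) else 0 := by
      intro j
      by_cases hj : q j = q i
      · have : q' j = q' l := by rw [h, hq, hj, hq]
        rw [if_pos hj, if_pos this, if_pos hj, h]; ring
      · simp [hj]
    simp_rw [this]
    rw [← Finset.sum_filter, ← Finset.sum_mul]
    change cellSum q p (q i) * _ = _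
    rw [mul_inv_cancel_left₀ h0]
  · rw [if_neg h]
    refine Finset.sum_eq_zero fun j _ => ?_
    by_cases hj : q j = q i
    · have : q' j ≠ q' l := fun hl => h (by rw [← hl, hq, hj, hq])
      rw [if_neg this, zero_mul]
    · rw [if_neg hj, mul_zero]

theorem sum_cellLaw_mul_cellRatio_of_coarser {q q' f : K → K} (hq : ∀ i, q i = f (q' i))
    {p : K → ℝ} (hp : ∀ j, 0 < p j) (l i : K) :
    ∑ j, cellLaw q' p l j * cellRatio q p i j = cellRatio q p i l := by
  classical
  have : ∀ j, cellLaw q' p l j * cellRatio q p i j = cellLaw q' p l j * cellRatio q p i l := by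
    intro j
    by_cases hj : q' j = q' l
    · unfold cellRatio
      rw [hq j, hq l, hj]
    · simp [cellLaw, hj]
  simp_rw [this]
  rw [← Finset.sum_mul, sum_cellLaw hp, one_mul]

theorem sum_cells_cellRatio (q : K → K) (p : K → ℝ) (j : K) {rep : K → K}
    (hrep : ∀ a ∈ cells q, q (rep a) = a) :
    ∑ a ∈ cells q, cellRatio q p (rep a) j = (cellSum q p (q j))⁻¹ := by
  classical
  have : ∀ a ∈ cells q, cellRatio q p (rep a) j = if q j = a then (cellSum q p a)⁻¹ else 0 := by
    intro a ha
    unfold cellRatio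
    rw [hrep a ha]
  rw [Finset.sum_congr rfl this, Finset.sum_ite_eq, if_pos (mem_cells q j)]

/-- The law `cellLaw` as a probability mass function. -/
noncomputable def cellPMF (q : K → K) (p : K → ℝ) (hp : ∀ j, 0 < p j) (l : K) : PMF K :=
  PMF.ofFintype (fun j => ENNReal.ofReal (cellLaw q p l j)) (by
    rw [← ENNReal.ofReal_sum_of_nonneg fun j _ => cellLaw_nonneg hp l j, sum_cellLaw hp,
      ENNReal.ofReal_one])

theorem cellPMF_toReal (q : K → K) (p : K → ℝ) (hp : ∀ j, 0 < p j) (l j : K) :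
    (cellPMF q p hp l j).toReal = cellLaw q p l j := by
  rw [cellPMF, PMF.ofFintype_apply, ENNReal.toReal_ofReal (cellLaw_nonneg hp l j)]

open scoped Classical in
/-- The importance weighted estimate of a loss function whose value `x` at `i` has been seen. -/
noncomputable def lossEstimate (p : K → ℝ) (i : K) (x : ℝ) (j : K) : ℝ :=
  if j = i then x / p i else 0

theorem sum_mul_lossEstimate {p : K → ℝ} (hp : ∀ j, 0 < p j) (i : K) (x : ℝ) :
    ∑ j, p j * lossEstimate p i x j = x := by
  classical
  simp [lossEstimate, mul_div_cancel₀ _ (hp i).ne']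

/-- Only the cell of `i` contributes: its mass times the square of its mean estimate, which is `x`
over that mass. -/
theorem sum_secondOrder_lossEstimate {p : K → ℝ} (hp : ∀ j, 0 < p j) (q : K → K) (i : K) (x : ℝ) :
    ∑ j, secondOrder q p (lossEstimate p i x) j = x ^ 2 * (cellSum q p (q i))⁻¹ := by
  classical
  have h1 : ∀ a, cellSum q (fun j => p j * lossEstimate p i x j) a = if q i = a then x else 0 := by
    intro a
    unfold cellSum lossEstimate
    simp [mul_div_cancel₀ _ (hp i).ne']
  rw [← sum_cells_cellSum q]
  simp_rw [cellSum_secondOrder, h1]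
  rw [Finset.sum_eq_single (q i)]
  · have := (cellSum_pos hp (mem_cells q i)).ne'
    rw [if_pos rfl]
    field_simp
  · intro b _ hb
    simp [hb.symm]
  · intro h
    exact absurd (mem_cells q i) h

end Refresh

/-! ### The level at which the learner stays in its cell. -/

section Level

open scoped Classical in
/-- The level of the partition whose cell must not be left in round `t`. -/
noncomputable def holdLevel (H t : ℕ) : ℕ :=
  Nat.find (p := fun h => h = H ∨ ¬ 2 ^ h ∣ t) ⟨H, Or.inl rfl⟩

theorem holdLevel_le (H t : ℕ) : holdLevel H t ≤ H := by
  classical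
  exact Nat.find_min' _ (Or.inl rfl)

theorem holdLevel_le_of_not_dvd {H t h : ℕ} (hh : h = H ∨ ¬ 2 ^ h ∣ t) : holdLevel H t ≤ h := by
  classical
  exact Nat.find_min' _ hh

theorem dvd_of_lt_holdLevel {H t h : ℕ} (hh : h < holdLevel H t) : 2 ^ h ∣ t := by
  classical
  have := Nat.find_min _ hh
  push Not at this
  exact this.2

theorem lt_holdLevel {H t h : ℕ} (hh : h < H) (hd : 2 ^ h ∣ t) : h < holdLevel H t := by
  classical
  by_contra hlt
  have hs : holdLevel H t = H ∨ ¬ 2 ^ holdLevel H t ∣ t :=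
    Nat.find_spec (p := fun h => h = H ∨ ¬ 2 ^ h ∣ t) ⟨H, Or.inl rfl⟩
  rcases hs with hs | hs
  · omega
  · exact hs ((pow_dvd_pow 2 (not_lt.1 hlt)).trans hd)

theorem holdLevel_zero (H : ℕ) : holdLevel H 0 = H := by
  refine le_antisymm (holdLevel_le H 0) (not_lt.1 fun h => ?_)
  exact lt_irrefl _ (lt_holdLevel h (dvd_zero _))

end Level

theorem exists_coarsening {K : Type u} {π f : ℕ → K → K} (hπ : ∀ h i, π (h + 1) i = f h (π h i))
    {m n : ℕ} (hmn : m ≤ n) : ∃ F : K → K, ∀ i, π n i = F (π m i) := by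
  induction n, hmn using Nat.le_induction with
  | base => exact ⟨id, fun _ => rfl⟩
  | succ n _ ih =>
    obtain ⟨F, hF⟩ := ih
    exact ⟨f n ∘ F, fun i => by rw [hπ, hF]; rfl⟩

/-- The memory of the lazy hierarchical learner: the round, the last action, the exponential weights
and the distribution that follows them lazily. -/
structure LazyState (K : Type u) where
  time : ℕ
  last : K
  w : K → ℝ
  p : K → ℝ
  w_pos : ∀ j, 0 < w j
  p_pos : ∀ j, 0 < p j

/-! ### The lazy learner and expectations over its actions. -/

namespace BanditAlgorithm

variable {K : Type u} (A : BanditAlgorithm K) {ℓ : ℕ → K → ℝ} {m₀ : A.Memory}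
  {upd : A.Memory → K → ℝ → A.Memory} {mem : (T : ℕ) → (Fin T → K) → A.Memory}

/-- With deterministic updates the memory is a function of the actions, so the randomness of a run
is that of the actions alone. -/
theorem play_of_deterministic (hinit : A.init = PMF.pure m₀)
    (hupd : ∀ m i x, A.update m i x = PMF.pure (upd m i x)) (hmem0 : ∀ i, mem 0 i = m₀)
    (hmem : ∀ T i j, mem (T + 1) (Fin.snoc i j) = upd (mem T i) j (ℓ T j)) (T : ℕ) :
    A.play ℓ T = (A.actionLaw ℓ T).map fun i => (i, mem T i) := by
  unfold BanditAlgorithm.actionLaw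
  rw [PMF.map_comp]
  induction T with
  | zero => simp [play, hinit, PMF.pure_map, hmem0]
  | succ T ih =>
    simp only [play]
    rw [ih]
    simp only [PMF.map_bind, PMF.bind_map, hupd, PMF.pure_map, Function.comp_def, hmem]

theorem actionLaw_succ_of_deterministic (hinit : A.init = PMF.pure m₀)
    (hupd : ∀ m i x, A.update m i x = PMF.pure (upd m i x)) (hmem0 : ∀ i, mem 0 i = m₀)
    (hmem : ∀ T i j, mem (T + 1) (Fin.snoc i j) = upd (mem T i) j (ℓ T j)) (T : ℕ) :
    A.actionLaw ℓ (T + 1) = (A.actionLaw ℓ T).bind fun i =>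
      (A.choose (mem T i)).map fun j => (Fin.snoc i j : Fin (T + 1) → K) := by
  conv_lhs => unfold BanditAlgorithm.actionLaw
  simp only [play]
  rw [A.play_of_deterministic hinit hupd hmem0 hmem]
  simp only [PMF.map_bind, PMF.bind_map, hupd, PMF.pure_map, Function.comp_def]
  rfl

end BanditAlgorithm

section Algorithm

variable {K : Type u} [Fintype K]

/-- The memory before the first round. -/
noncomputable def LazyState.start (i₀ : K) : LazyState K where
  time := 0
  last := i₀
  w _ := 1
  p _ := (Fintype.card K : ℝ)⁻¹
  w_pos _ := one_pos
  p_pos _ := inv_pos.2 (Nat.cast_pos.2 (Fintype.card_pos_iff.2 ⟨i₀⟩))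

/-- The memory after the loss `x` of the action `i` has been seen. -/
noncomputable def LazyState.next (π : ℕ → K → K) (H : ℕ) (η : ℝ) (S : LazyState K) (i : K) (x : ℝ) :
    LazyState K where
  time := S.time + 1
  last := i
  w j := S.w j * Real.exp (-(η * lossEstimate S.p i x j))
  p := refresh (π (holdLevel H (S.time + 1))) S.p
    fun j => S.w j * Real.exp (-(η * lossEstimate S.p i x j))
  w_pos j := mul_pos (S.w_pos j) (Real.exp_pos _)
  p_pos := refresh_pos S.p_pos fun j => mul_pos (S.w_pos j) (Real.exp_pos _)

/-- Exponential weights that follow the partitions `π 0, …, π H` lazily. -/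
noncomputable def lazyAlgorithm (π : ℕ → K → K) (H : ℕ) (η : ℝ) (i₀ : K) : BanditAlgorithm K where
  Memory := LazyState K
  init := PMF.pure (LazyState.start i₀)
  choose S := cellPMF (π (holdLevel H S.time)) S.p S.p_pos S.last
  update S i x := PMF.pure (S.next π H η i x)

variable (π : ℕ → K → K) (H : ℕ) (η : ℝ) (i₀ : K) (ℓ : ℕ → K → ℝ)

/-- The memory before round `t` when the actions are given by `x`. -/
noncomputable def lazyState (x : ℕ → K) : ℕ → LazyState K
  | 0 => LazyState.start i₀
  | t + 1 => (lazyState x t).next π H η (x t) (ℓ t (x t))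

theorem lazyState_time (x : ℕ → K) (t : ℕ) : (lazyState π H η i₀ ℓ x t).time = t := by
  induction t with
  | zero => rfl
  | succ t ih =>
    change (lazyState π H η i₀ ℓ x t).time + 1 = t + 1
    rw [ih]

theorem lazyState_congr {x y : ℕ → K} {t : ℕ} (h : ∀ s < t, x s = y s) :
    lazyState π H η i₀ ℓ x t = lazyState π H η i₀ ℓ y t := by
  induction t with
  | zero => rfl
  | succ t ih =>
    simp only [lazyState]
    rw [ih fun s hs => h s (by omega), h t (Nat.lt_succ_self t)]

theorem lazyState_update (x : ℕ → K) (t : ℕ) (j : K) :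
    lazyState π H η i₀ ℓ (Function.update x t j) t = lazyState π H η i₀ ℓ x t :=
  lazyState_congr π H η i₀ ℓ fun _ hs => Function.update_of_ne hs.ne _ _

theorem lazyState_succ_last (x : ℕ → K) (t : ℕ) :
    (lazyState π H η i₀ ℓ x (t + 1)).last = x t := rfl

theorem lazyState_succ_p (x : ℕ → K) (t : ℕ) :
    (lazyState π H η i₀ ℓ x (t + 1)).p = refresh (π (holdLevel H (t + 1)))
      (lazyState π H η i₀ ℓ x t).p (lazyState π H η i₀ ℓ x (t + 1)).w := by
  change refresh (π (holdLevel H ((lazyState π H η i₀ ℓ x t).time + 1))) _ _ = _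
  rw [lazyState_time]
  rfl

variable {π} {f : ℕ → K → K}

theorem cellSum_lazyState_succ (hπ : ∀ h i, π (h + 1) i = f h (π h i)) (x : ℕ → K) {t h : ℕ}
    (hh : holdLevel H (t + 1) ≤ h) (a : K) :
    cellSum (π h) (lazyState π H η i₀ ℓ x (t + 1)).p a
      = cellSum (π h) (lazyState π H η i₀ ℓ x t).p a := by
  obtain ⟨F, hF⟩ := exists_coarsening hπ hh
  rw [lazyState_succ_p]
  exact cellSum_refresh hF (LazyState.w_pos _) a

theorem isLazyWeights_lazyState (hπ : ∀ h i, π (h + 1) i = f h (π h i)) (x : ℕ → K)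
    (hℓ : ∀ t i, 0 ≤ ℓ t i) :
    IsLazyWeights π H η (fun t => (lazyState π H η i₀ ℓ x t).p)
      (fun t => (lazyState π H η i₀ ℓ x t).w)
      (fun t => lossEstimate (lazyState π H η i₀ ℓ x t).p (x t) (ℓ t (x t))) where
  p_pos t := LazyState.p_pos _
  w_pos t := LazyState.w_pos _
  g_nonneg t j := by
    unfold lossEstimate
    split_ifs
    · exact div_nonneg (hℓ _ _) (LazyState.p_pos _ _).le
    · exact le_rfl
  w_succ t j := rfl
  proportional t h hh hd i j hij := by
    cases t with
    | zero => rfl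
    | succ t =>
      -- At a multiple of `2 ^ h` the hold level is at least `h + 1`, so cells of level `h + 1` lie
      -- within the cells where `p` was made proportional to `w`.
      obtain ⟨F, hF⟩ := exists_coarsening hπ (Nat.succ_le_of_lt (lt_holdLevel hh hd))
      simp only [lazyState_succ_p, refresh]
      rw [hF i, hF j, hij]
      ring
  keep t h hh hd a :=
    cellSum_lazyState_succ H η i₀ ℓ hπ x (holdLevel_le_of_not_dvd hd) a

variable (π)

/-- The expectation of a function of the actions played in the first `T` rounds. -/
noncomputable def lazyExpectation (T : ℕ) (F : (ℕ → K) → ℝ) : ℝ :=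
  ∑ i : Fin T → K, ((lazyAlgorithm π H η i₀).actionLaw ℓ T i).toReal * F (extendPath i₀ i)

theorem lazyExpectation_succ (T : ℕ) (F : (ℕ → K) → ℝ) :
    lazyExpectation π H η i₀ ℓ (T + 1) F = lazyExpectation π H η i₀ ℓ T fun x =>
      ∑ j, cellLaw (π (holdLevel H T)) (lazyState π H η i₀ ℓ x T).p
        (lazyState π H η i₀ ℓ x T).last j * F (Function.update x T j) := by
  have h := (lazyAlgorithm π H η i₀).actionLaw_succ_of_deterministic (ℓ := ℓ)
    (upd := LazyState.next π H η) (m₀ := LazyState.start i₀)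
    (mem := fun T i => lazyState π H η i₀ ℓ (extendPath i₀ i) T)
    rfl (fun _ _ _ => rfl) (fun _ => rfl)
    (fun T i j => by
      simp only [lazyState, extendPath_snoc, lazyState_update, Function.update_self]
      rfl) T
  unfold lazyExpectation
  rw [h, PMF.sum_bind_toReal_mul]
  refine Finset.sum_congr rfl fun i _ => ?_
  rw [PMF.sum_map_toReal_mul]
  simp only [lazyAlgorithm, lazyState_time, cellPMF_toReal, extendPath_snoc]

theorem lazyExpectation_const (T : ℕ) (c : ℝ) :
    lazyExpectation π H η i₀ ℓ T (fun _ => c) = c := by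
  unfold lazyExpectation
  rw [← Finset.sum_mul, PMF.sum_toReal_eq_one, one_mul]

theorem lazyExpectation_mono (T : ℕ) {F G : (ℕ → K) → ℝ} (h : ∀ x, F x ≤ G x) :
    lazyExpectation π H η i₀ ℓ T F ≤ lazyExpectation π H η i₀ ℓ T G :=
  Finset.sum_le_sum fun _ _ => mul_le_mul_of_nonneg_left (h _) ENNReal.toReal_nonneg

theorem lazyExpectation_add (T : ℕ) (F G : (ℕ → K) → ℝ) :
    lazyExpectation π H η i₀ ℓ T (fun x => F x + G x)
      = lazyExpectation π H η i₀ ℓ T F + lazyExpectation π H η i₀ ℓ T G := by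
  unfold lazyExpectation
  simp only [mul_add, Finset.sum_add_distrib]

theorem lazyExpectation_mul_left (T : ℕ) (c : ℝ) (F : (ℕ → K) → ℝ) :
    lazyExpectation π H η i₀ ℓ T (fun x => c * F x) = c * lazyExpectation π H η i₀ ℓ T F := by
  unfold lazyExpectation
  rw [Finset.mul_sum]
  exact Finset.sum_congr rfl fun _ _ => mul_left_comm _ _ _

theorem lazyExpectation_sum {ι : Type*} (s : Finset ι) (T : ℕ) (F : ι → (ℕ → K) → ℝ) :
    lazyExpectation π H η i₀ ℓ T (fun x => ∑ b ∈ s, F b x)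
      = ∑ b ∈ s, lazyExpectation π H η i₀ ℓ T (F b) := by
  unfold lazyExpectation
  simp only [Finset.mul_sum]
  exact Finset.sum_comm

/-- A conditional law has total mass `1`, so rounds on which `F` does not depend integrate out. -/
theorem lazyExpectation_eq_of_le {t T : ℕ} (htT : t ≤ T) {F : (ℕ → K) → ℝ}
    (hF : ∀ x y : ℕ → K, (∀ s < t, x s = y s) → F x = F y) :
    lazyExpectation π H η i₀ ℓ T F = lazyExpectation π H η i₀ ℓ t F := by
  induction T, htT using Nat.le_induction with
  | base => rfl
  | succ T hT ih =>
    rw [lazyExpectation_succ, ← ih]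
    congr 1
    funext x
    have : ∀ j, F (Function.update x T j) = F x := fun j =>
      hF _ _ fun s hs => Function.update_of_ne (by omega) _ _
    simp only [this]
    rw [← Finset.sum_mul, sum_cellLaw (LazyState.p_pos _), one_mul]

end Algorithm

/-! ### Expected regret of the lazy learner for a given hierarchy. -/

section Regret

variable {K : Type u} [Fintype K] {π f : ℕ → K → K} {H : ℕ} {η : ℝ} {i₀ : K} {ℓ : ℕ → K → ℝ}

theorem sum_start_p (i₀ : K) : ∑ j, (LazyState.start i₀).p j = 1 := by
  have : (Fintype.card K : ℝ) ≠ 0 := Nat.cast_ne_zero.2 (Fintype.card_pos_iff.2 ⟨i₀⟩).ne'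
  simp [LazyState.start, this]

/-- The action played in round `t` hits every cell with the probability that its mass promises. -/
theorem lazyExpectation_cellRatio (hπ : ∀ h i, π (h + 1) i = f h (π h i))
    (hconst : ∀ i j, π H i = π H j) (i : K) (t : ℕ) {h : ℕ} (hh : h ≤ H) :
    lazyExpectation π H η i₀ ℓ (t + 1)
      (fun x => cellRatio (π h) (lazyState π H η i₀ ℓ x t).p i (x t)) = 1 := by
  -- Averaging over the action of round `t` replaces `h` by the hold level if that is coarser. At
  -- that level masses did not change since the round before, which makes induction on `t` possible.
  have step : ∀ (t h : ℕ), h ≤ H → ∀ x : ℕ → K,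
      ∑ j, cellLaw (π (holdLevel H t)) (lazyState π H η i₀ ℓ x t).p
        (lazyState π H η i₀ ℓ x t).last j *
          cellRatio (π h) (lazyState π H η i₀ ℓ x t).p i j
      = cellRatio (π (max h (holdLevel H t))) (lazyState π H η i₀ ℓ x t).p i
          (lazyState π H η i₀ ℓ x t).last := by
    intro t h _ x
    rcases le_total h (holdLevel H t) with hle | hle
    · obtain ⟨F, hF⟩ := exists_coarsening hπ hle
      rw [max_eq_right hle]
      exact sum_cellLaw_mul_cellRatio_of_finer hF (LazyState.p_pos _) _ i
    · obtain ⟨F, hF⟩ := exists_coarsening hπ hle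
      rw [max_eq_left hle]
      exact sum_cellLaw_mul_cellRatio_of_coarser hF (LazyState.p_pos _) _ i
  induction t generalizing h with
  | zero =>
    rw [lazyExpectation_succ]
    simp only [lazyState_update, Function.update_self, step 0 h hh]
    -- In round `0` the hold level is the trivial partition, so the arbitrary initial `last` does
    -- not matter.
    rw [holdLevel_zero, max_eq_right hh]
    refine Eq.trans ?_ (lazyExpectation_const π H η i₀ ℓ 0 1)
    congr 1
    funext x
    unfold cellRatio
    rw [if_pos (hconst _ _), cellSum_of_const fun j => hconst j i]
    exact inv_eq_one.2 (sum_start_p i₀)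
  | succ t ih =>
    rw [lazyExpectation_succ]
    simp only [lazyState_update, Function.update_self, step (t + 1) h hh]
    refine Eq.trans ?_ (ih (max_le hh (holdLevel_le H (t + 1))))
    congr 1
    funext x
    unfold cellRatio
    rw [cellSum_lazyState_succ H η i₀ ℓ hπ x (le_max_right _ _), lazyState_succ_last]

theorem lazyExpectation_dist_le [MetricSpace K] {D : ℕ → ℝ}
    (hD : ∀ h ≤ H, ∀ i j, π h i = π h j → dist i j ≤ D h) (t : ℕ) :
    lazyExpectation π H η i₀ ℓ (t + 2) (fun x => dist (x (t + 1)) (x t))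
      ≤ D (holdLevel H (t + 1)) := by
  rw [lazyExpectation_succ]
  refine (lazyExpectation_mono π H η i₀ ℓ _ fun x => ?_).trans
    (lazyExpectation_const π H η i₀ ℓ _ (D (holdLevel H (t + 1)))).le
  have h1 : ∀ j, cellLaw (π (holdLevel H (t + 1))) (lazyState π H η i₀ ℓ x (t + 1)).p
        (lazyState π H η i₀ ℓ x (t + 1)).last j *
          dist (Function.update x (t + 1) j (t + 1)) (Function.update x (t + 1) j t)
      ≤ cellLaw (π (holdLevel H (t + 1))) (lazyState π H η i₀ ℓ x (t + 1)).p
        (lazyState π H η i₀ ℓ x (t + 1)).last j * D (holdLevel H (t + 1)) := by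
    intro j
    rw [Function.update_self, Function.update_of_ne (Nat.lt_succ_self t).ne]
    by_cases hj : π (holdLevel H (t + 1)) j = π (holdLevel H (t + 1)) (x t)
    · exact mul_le_mul_of_nonneg_left (hD _ (holdLevel_le _ _) _ _ hj)
        (cellLaw_nonneg (LazyState.p_pos _) _ _)
    · simp [cellLaw, lazyState_succ_last, hj]
  refine (Finset.sum_le_sum fun j _ => h1 j).trans_eq ?_
  rw [← Finset.sum_mul, sum_cellLaw (LazyState.p_pos _), one_mul]

/-- The regret without movement for fixed actions `x`, with the losses of `i` replaced by their
estimates. -/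
theorem sum_loss_le_sum_lossEstimate (hη : 0 < η) (hπ : ∀ h i, π (h + 1) i = f h (π h i))
    (hπ0 : ∀ i, π 0 i = i) (hconst : ∀ i j, π H i = π H j) {T : ℕ}
    (hℓ : ∀ t i, ℓ t i ∈ Set.Icc (0 : ℝ) 1) (hT : ∀ t, T ≤ t → ∀ i, ℓ t i = 0) (x : ℕ → K) (i : K) :
    ∑ t ∈ Finset.range T, ℓ t (x t)
      ≤ ∑ t ∈ Finset.range T, lossEstimate (lazyState π H η i₀ ℓ x t).p (x t) (ℓ t (x t)) i
        + Real.log (Fintype.card K) / η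
        + η / 2 * ∑ h ∈ Finset.range H, 2 ^ h * ∑ t ∈ Finset.range T,
          (cellSum (π h) (lazyState π H η i₀ ℓ x t).p (π h (x t)))⁻¹ := by
  have R := (isLazyWeights_lazyState H η i₀ ℓ hπ x fun t i => (hℓ t i).1).regret_le hη hπ hπ0 hconst
    (sum_start_p i₀) (fun _ => rfl) T i
  simp only [sum_mul_lossEstimate (LazyState.p_pos _),
    sum_secondOrder_lossEstimate (LazyState.p_pos _)] at R
  have hsub : ∀ F : ℕ → ℝ, (∀ t, T ≤ t → F t = 0) →
      ∑ t ∈ Finset.range (T * 2 ^ H), F t = ∑ t ∈ Finset.range T, F t := by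
    intro F hF
    refine (Finset.sum_subset (Finset.range_mono ?_) fun t _ ht => hF t ?_).symm
    · exact Nat.le_mul_of_pos_right T (Nat.two_pow_pos H)
    · simpa using ht
  rw [hsub _ fun t ht => hT t ht _, hsub _ fun t ht => by simp [lossEstimate, hT t ht]] at R
  refine R.trans (add_le_add_right (mul_le_mul_of_nonneg_left ?_ (half_pos hη).le) _)
  refine Finset.sum_le_sum fun h _ => mul_le_mul_of_nonneg_left ?_ (by positivity)
  rw [hsub _ fun t ht => by simp [hT t ht]]
  refine Finset.sum_le_sum fun t _ => mul_le_of_le_one_left ?_ (pow_le_one₀ (hℓ _ _).1 (hℓ _ _).2)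
  exact inv_nonneg.2 (cellSum_nonneg (fun j => (LazyState.p_pos _ j).le) _)

theorem movementRegret_lazyAlgorithm_le_of_eq_zero [MetricSpace K] [Nonempty K] (hη : 0 < η)
    (hπ : ∀ h i, π (h + 1) i = f h (π h i)) (hπ0 : ∀ i, π 0 i = i)
    (hconst : ∀ i j, π H i = π H j) {D : ℕ → ℝ}
    (hD : ∀ h ≤ H, ∀ i j, π h i = π h j → dist i j ≤ D h) {T : ℕ}
    (hℓ : ∀ t i, ℓ t i ∈ Set.Icc (0 : ℝ) 1) (hT : ∀ t, T ≤ t → ∀ i, ℓ t i = 0) :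
    movementRegret (lazyAlgorithm π H η i₀) ℓ T ≤ Real.log (Fintype.card K) / η
      + η / 2 * ∑ h ∈ Finset.range H, (2 : ℝ) ^ h * (T * (cells (π h)).card)
      + ∑ t ∈ Finset.range (T - 1), D (holdLevel H (t + 1)) := by
  have hE : ∑ i : Fin T → K, ((lazyAlgorithm π H η i₀).actionLaw ℓ T i).toReal * totalCost ℓ i
      = lazyExpectation π H η i₀ ℓ T (fun x => ∑ t ∈ Finset.range T, ℓ t (x t))
        + lazyExpectation π H η i₀ ℓ T
          (fun x => ∑ t ∈ Finset.range (T - 1), dist (x (t + 1)) (x t)) := by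
    rw [← lazyExpectation_add]
    unfold lazyExpectation
    exact Finset.sum_congr rfl fun i _ => by rw [totalCost_eq i₀]
  have hmove : lazyExpectation π H η i₀ ℓ T
      (fun x => ∑ t ∈ Finset.range (T - 1), dist (x (t + 1)) (x t))
      ≤ ∑ t ∈ Finset.range (T - 1), D (holdLevel H (t + 1)) := by
    rw [lazyExpectation_sum]
    refine Finset.sum_le_sum fun t ht => ?_
    have ht' := Finset.mem_range.1 ht
    rw [lazyExpectation_eq_of_le π H η i₀ ℓ (t := t + 2) (by omega)
      fun x y hxy => by rw [hxy _ (by omega), hxy _ (by omega)]]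
    exact lazyExpectation_dist_le hD t
  have hratio : ∀ t ∈ Finset.range T, ∀ h ≤ H, ∀ i, lazyExpectation π H η i₀ ℓ T
      (fun x => cellRatio (π h) (lazyState π H η i₀ ℓ x t).p i (x t)) = 1 := by
    intro t ht h hh i
    have ht' := Finset.mem_range.1 ht
    rw [lazyExpectation_eq_of_le π H η i₀ ℓ (t := t + 1) (by omega)
      fun x y hxy => by
        rw [hxy _ (by omega), lazyState_congr π H η i₀ ℓ fun s hs => hxy s (by omega)]]
    exact lazyExpectation_cellRatio hπ hconst i t hh
  have hinv : ∀ t ∈ Finset.range T, ∀ h ≤ H, lazyExpectation π H η i₀ ℓ T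
      (fun x => (cellSum (π h) (lazyState π H η i₀ ℓ x t).p (π h (x t)))⁻¹)
      = (cells (π h)).card := by
    intro t ht h hh
    have hrep : ∀ a : K, ∃ i, a ∈ cells (π h) → π h i = a := by
      intro a
      by_cases ha : a ∈ cells (π h)
      · obtain ⟨i, hi⟩ := exists_of_mem_cells ha
        exact ⟨i, fun _ => hi⟩
      · exact ⟨a, fun h => absurd h ha⟩
    choose rep hrep using hrep
    -- The inverse mass of the played cell is the sum of the ratios of all cells, each of
    -- expectation `1`.
    simp only [← sum_cells_cellRatio _ _ _ hrep]
    rw [lazyExpectation_sum, Finset.sum_congr rfl fun a _ => hratio t ht h hh (rep a)]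
    simp
  have hest : ∀ t ∈ Finset.range T, ∀ i, lazyExpectation π H η i₀ ℓ T
      (fun x => lossEstimate (lazyState π H η i₀ ℓ x t).p (x t) (ℓ t (x t)) i) = ℓ t i := by
    intro t ht i
    have e : ∀ x : ℕ → K, lossEstimate (lazyState π H η i₀ ℓ x t).p (x t) (ℓ t (x t)) i
        = ℓ t i * cellRatio (π 0) (lazyState π H η i₀ ℓ x t).p i (x t) := by
      intro x
      unfold lossEstimate cellRatio
      rw [hπ0, hπ0, cellSum_of_injective hπ0]
      by_cases hx : i = x t
      · rw [if_pos hx, if_pos hx.symm, ← hx, div_eq_mul_inv]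
      · rw [if_neg hx, if_neg (Ne.symm hx), mul_zero]
    simp only [e]
    rw [lazyExpectation_mul_left, hratio t ht 0 (Nat.zero_le H), mul_one]
  have hloss : ∀ i, lazyExpectation π H η i₀ ℓ T (fun x => ∑ t ∈ Finset.range T, ℓ t (x t))
      ≤ ∑ t ∈ Finset.range T, ℓ t i + Real.log (Fintype.card K) / η
        + η / 2 * ∑ h ∈ Finset.range H, (2 : ℝ) ^ h * (T * (cells (π h)).card) := by
    intro i
    refine (lazyExpectation_mono π H η i₀ ℓ T fun x =>
      sum_loss_le_sum_lossEstimate (i₀ := i₀) hη hπ hπ0 hconst hℓ hT x i).trans_eq ?_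
    simp only [lazyExpectation_add, lazyExpectation_mul_left, lazyExpectation_sum,
      lazyExpectation_const]
    congr 2
    · exact Finset.sum_congr rfl fun t ht => hest t ht i
    refine Finset.sum_congr rfl fun h hh => ?_
    congr 1
    refine (Finset.sum_congr rfl fun t ht => hinv t ht h (Finset.mem_range.1 hh).le).trans ?_
    simp
  unfold movementRegret
  rw [hE, sub_le_comm]
  refine le_ciInf fun i => ?_
  linarith [hloss i]

/-- The movement regret of the lazy hierarchical learner. -/
theorem movementRegret_lazyAlgorithm_le [MetricSpace K] [Nonempty K] (hη : 0 < η)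
    (hπ : ∀ h i, π (h + 1) i = f h (π h i)) (hπ0 : ∀ i, π 0 i = i)
    (hconst : ∀ i j, π H i = π H j) {D : ℕ → ℝ}
    (hD : ∀ h ≤ H, ∀ i j, π h i = π h j → dist i j ≤ D h) {T : ℕ}
    (hℓ : ∀ t < T, ∀ i, ℓ t i ∈ Set.Icc (0 : ℝ) 1) :
    movementRegret (lazyAlgorithm π H η i₀) ℓ T ≤ Real.log (Fintype.card K) / η
      + η / 2 * ∑ h ∈ Finset.range H, (2 : ℝ) ^ h * (T * (cells (π h)).card)
      + ∑ t ∈ Finset.range (T - 1), D (holdLevel H (t + 1)) := by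
  -- Losses are set to zero from `T` on, so the pathwise bound can be used at horizon `T * 2 ^ H`, a
  -- multiple of the longest block.
  rw [movementRegret_congr (ℓ' := fun t i => if t < T then ℓ t i else 0) _
    fun t ht => by simp [ht]]
  refine movementRegret_lazyAlgorithm_le_of_eq_zero hη hπ hπ0 hconst hD ?_ ?_
  · intro t i
    by_cases ht : t < T
    · simpa [ht] using hℓ t ht i
    · simp [ht]
  · intro t ht i
    simp [not_lt.2 ht]

end Regret

/-! ### Hierarchies from minimal covers. -/

section Covering

variable {K : Type u} [MetricSpace K] [Fintype K]

/-- Rounding to a smallest cover of radius `ε`. -/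
theorem exists_rounding (ε : ℝ≥0) (h0 : 0 < ε) (h1 : ε < 1) :
    ∃ (g : K → K) (N : Finset K), (∀ i, g i ∈ N) ∧ (∀ i, dist i (g i) ≤ ε) ∧
      (ε : ℝ) * N.card ≤ (coveringComplexity K).toReal := by
  classical
  have hN : Metric.coveringNumber ε (Set.univ : Set K) ≠ ⊤ := by
    refine ne_top_of_le_ne_top ?_ (Metric.coveringNumber_le_encard_self (ε := ε) Set.univ)
    exact Set.encard_ne_top_iff.2 Set.finite_univ
  obtain ⟨N, _, hfin, hcov, hcard⟩ := Metric.exists_set_encard_eq_coveringNumber hN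
  have hcov' : ∀ i : K, ∃ j ∈ N, dist i j ≤ ε := by
    intro i
    obtain ⟨j, hj, hij⟩ := hcov (Set.mem_univ i)
    refine ⟨j, hj, ?_⟩
    rw [← coe_nndist]
    have : edist i j ≤ ε := hij
    rw [edist_nndist] at this
    exact_mod_cast this
  choose g hg hd using hcov'
  refine ⟨g, hfin.toFinset, fun i => hfin.mem_toFinset.2 (hg i), hd, ?_⟩
  have hle : (ε : ℝ≥0∞) * ((Metric.coveringNumber ε (Set.univ : Set K) : ℕ∞) : ℝ≥0∞)
      ≤ coveringComplexity K := le_iSup_of_le ε (le_iSup_of_le h0 (le_iSup_of_le h1 le_rfl))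
  rw [← hcard, hfin.encard_eq_coe_toFinset_card] at hle
  have := ENNReal.toReal_mono (coveringComplexity_ne_top K) hle
  simpa using this

theorem half_le_coveringComplexity [Nonempty K] : 1 / 2 ≤ (coveringComplexity K).toReal := by
  obtain ⟨g, N, hg, _, hN⟩ := exists_rounding (K := K) (1 / 2) (by norm_num) (by
    rw [← NNReal.coe_lt_coe]; norm_num)
  have hpos : 1 ≤ N.card := Finset.card_pos.2 ⟨_, hg (Classical.arbitrary K)⟩
  have : (1 : ℝ) ≤ N.card := by exact_mod_cast hpos
  push_cast at hN
  linarith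

theorem coveringComplexity_toReal_le_card : (coveringComplexity K).toReal ≤ Fintype.card K := by
  have := ENNReal.toReal_mono (ENNReal.natCast_ne_top _) (coveringComplexity_le_card K)
  simpa using this

/-- Iterated rounding along the maps `f 0, f 1, …`. -/
def iteratedRounding (f : ℕ → K → K) : ℕ → K → K
  | 0, i => i
  | h + 1, i => f h (iteratedRounding f h i)

/-- A hierarchy of partitions, where the cells of level `h` have diameter of order `2 ^ (h - H)`
and are about as few as the covering complexity permits. -/
theorem exists_hierarchy [Nonempty K] (hdiam : ∀ i j : K, dist i j ≤ 1) (H : ℕ) (hH : 0 < H) :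
    ∃ π f : ℕ → K → K, (∀ h i, π (h + 1) i = f h (π h i)) ∧ (∀ i, π 0 i = i) ∧
      (∀ i j, π H i = π H j) ∧
      (∀ h ≤ H, ∀ i j, π h i = π h j → dist i j ≤ 4 * 2 ^ h / 2 ^ H) ∧
      (∀ h, h + 1 < H → 2 ^ (h + 1) * ((cells (π (h + 1))).card : ℝ)
        ≤ (coveringComplexity K).toReal * 2 ^ H) := by
  classical
  -- The radius doubles with each level. It must stay below `1` for the covering complexity to
  -- apply, so from level `H` on everything is collapsed to one point.
  have hex : ∀ h : ℕ, ∃ (g : K → K) (N : Finset K), (∀ i, g i ∈ N) ∧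
      (h + 1 < H → ∀ i, dist i (g i) ≤ 2 ^ (h + 1) / 2 ^ H) ∧
      (h + 1 < H → (2 ^ (h + 1) / 2 ^ H : ℝ) * N.card ≤ (coveringComplexity K).toReal) ∧
      (H ≤ h + 1 → ∀ i j, g i = g j) := by
    intro h
    by_cases hh : h + 1 < H
    · obtain ⟨g, N, hg, hd, hN⟩ := exists_rounding (K := K) (2 ^ (h + 1) / 2 ^ H) (by positivity)
        (by
          rw [div_lt_one (by positivity)]
          exact pow_lt_pow_right₀ one_lt_two hh)
      push_cast at hd hN
      exact ⟨g, N, hg, fun _ => hd, fun _ => hN, fun h' => absurd hh (not_lt.2 h')⟩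
    · exact ⟨fun _ => Classical.arbitrary K, Finset.univ, by simp, fun h' => absurd h' hh,
        fun h' => absurd h' hh, fun _ _ _ => rfl⟩
  choose f N hfN hfd hfc hfconst using hex
  refine ⟨iteratedRounding f, f, fun _ _ => rfl, fun _ => rfl, ?_, ?_, ?_⟩
  · obtain ⟨n, rfl⟩ := Nat.exists_eq_succ_of_ne_zero hH.ne'
    exact fun i j => hfconst n le_rfl _ _
  · have hdist : ∀ h < H, ∀ i, dist i (iteratedRounding f h i) ≤ 2 * 2 ^ h / 2 ^ H := by
      intro h
      induction h with
      | zero =>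
        intro _ i
        simp only [iteratedRounding, dist_self]
        positivity
      | succ h ih =>
        intro hh i
        refine (dist_triangle _ (iteratedRounding f h i) _).trans
          ((add_le_add (ih (by omega) i) (hfd h hh _)).trans_eq ?_)
        rw [pow_succ]; ring
    intro h hh i j hij
    rcases hh.lt_or_eq with hlt | rfl
    · have h1 := hdist h hlt i
      have h2 := hdist h hlt j
      rw [← hij, dist_comm] at h2
      refine (dist_triangle _ (iteratedRounding f h i) _).trans ((add_le_add h1 h2).trans_eq ?_)
      ring
    · refine (hdiam i j).trans ?_
      rw [mul_div_cancel_right₀ _ (by positivity)]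
      norm_num
  · intro h hh
    have hcard : (cells (iteratedRounding f (h + 1))).card ≤ (N h).card := by
      refine Finset.card_le_card fun a ha => ?_
      obtain ⟨i, rfl⟩ := exists_of_mem_cells ha
      exact hfN h _
    have hcard' : ((cells (iteratedRounding f (h + 1))).card : ℝ) ≤ (N h).card := by
      exact_mod_cast hcard
    have h1 := hfc h hh
    rw [div_mul_eq_mul_div, div_le_iff₀ (by positivity)] at h1
    exact (mul_le_mul_of_nonneg_left hcard' (by positivity)).trans h1

end Covering

/-- A round with hold level `r + 1` is a multiple of `2 ^ r`. There are at most `T / 2 ^ r` such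
rounds, each of cost `8 * 2 ^ r / 2 ^ H`, so every level contributes the same bound. -/
theorem sum_holdLevel_le {H : ℕ} (hH : 0 < H) (T : ℕ) :
    ∑ t ∈ Finset.range (T - 1), (4 * 2 ^ holdLevel H (t + 1) / 2 ^ H : ℝ) ≤ 8 * H * (T / 2 ^ H) := by
  have h1 : ∀ t, (4 * 2 ^ holdLevel H (t + 1) / 2 ^ H : ℝ)
      ≤ ∑ h ∈ Finset.range H, if 2 ^ h ∣ t + 1 then (8 * 2 ^ h / 2 ^ H : ℝ) else 0 := by
    intro t
    have hpos : 0 < holdLevel H (t + 1) := lt_holdLevel hH (by simp)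
    obtain ⟨r, hr⟩ := Nat.exists_eq_succ_of_ne_zero hpos.ne'
    have hrH : r < H := by have := holdLevel_le H (t + 1); omega
    have hd : 2 ^ r ∣ t + 1 := dvd_of_lt_holdLevel (H := H) (by omega)
    refine le_trans (le_of_eq ?_) (Finset.single_le_sum (f := fun h =>
      if 2 ^ h ∣ t + 1 then (8 * 2 ^ h / 2 ^ H : ℝ) else 0) (fun h _ => ?_)
      (Finset.mem_range.2 hrH))
    · rw [hr]
      simp only [if_pos hd]
      rw [Nat.succ_eq_add_one, pow_succ]; ring
    · split_ifs <;> positivity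
  refine (Finset.sum_le_sum fun t _ => h1 t).trans ?_
  rw [Finset.sum_comm]
  have h2 : ∀ h ∈ Finset.range H, ∑ t ∈ Finset.range (T - 1),
      (if 2 ^ h ∣ t + 1 then (8 * 2 ^ h / 2 ^ H : ℝ) else 0) ≤ 8 * (T / 2 ^ H) := by
    intro h _
    rw [← Finset.sum_filter, Finset.sum_const, Nat.card_multiples, nsmul_eq_mul]
    have h3 : (((T - 1) / 2 ^ h : ℕ) : ℝ) ≤ T / 2 ^ h := by
      refine Nat.cast_div_le.trans ?_
      push_cast
      gcongr
      exact Nat.sub_le T 1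
    refine (mul_le_mul_of_nonneg_right h3 (by positivity)).trans_eq ?_
    field_simp
  refine (Finset.sum_le_sum h2).trans_eq ?_
  rw [Finset.sum_const, Finset.card_range, nsmul_eq_mul]
  ring

/-! ### Choice of the parameters and the upper bound. -/

section UpperBound

variable {K : Type u} [MetricSpace K] [Fintype K] [Nonempty K]

theorem exists_movementRegret_le (hdiam : ∀ i j : K, dist i j ≤ 1) {H : ℕ} (hH : 0 < H) {η : ℝ}
    (hη : 0 < η) (T : ℕ) : ∃ A : BanditAlgorithm K,
      ∀ ℓ : ℕ → K → ℝ, (∀ t < T, ∀ i : K, ℓ t i ∈ Set.Icc (0 : ℝ) 1) →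
        movementRegret A ℓ T ≤ Real.log (Fintype.card K) / η
          + η / 2 * (Fintype.card K * T + H * ((coveringComplexity K).toReal * 2 ^ H * T))
          + 8 * H * (T / 2 ^ H) := by
  obtain ⟨π, f, hπ, hπ0, hconst, hD, hcard⟩ := exists_hierarchy hdiam H hH
  refine ⟨lazyAlgorithm π H η (Classical.arbitrary K), fun ℓ hℓ => ?_⟩
  refine (movementRegret_lazyAlgorithm_le hη hπ hπ0 hconst hD hℓ).trans ?_
  refine add_le_add (add_le_add_right (mul_le_mul_of_nonneg_left ?_ (half_pos hη).le) _)
    (sum_holdLevel_le hH T)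
  have hC : 0 ≤ (coveringComplexity K).toReal * 2 ^ H * T := by positivity
  obtain ⟨n, rfl⟩ := Nat.exists_eq_succ_of_ne_zero hH.ne'
  -- Level `0` is split off: its cells are the single points, and it gives the term `k T`.
  rw [Finset.sum_range_succ']
  have h0 : ((cells (π 0)).card : ℝ) ≤ Fintype.card K := by exact_mod_cast Finset.card_le_univ _
  have h1 : ∀ h ∈ Finset.range n, (2 : ℝ) ^ (h + 1) * (T * (cells (π (h + 1))).card)
      ≤ (coveringComplexity K).toReal * 2 ^ (n + 1) * T := by
    intro h hh
    have := mul_le_mul_of_nonneg_right (hcard h (by have := Finset.mem_range.1 hh; omega))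
      (Nat.cast_nonneg T)
    calc _ = 2 ^ (h + 1) * ((cells (π (h + 1))).card : ℝ) * T := by ring
      _ ≤ _ := this
  have h2 := Finset.sum_le_sum h1
  rw [Finset.sum_const, Finset.card_range, nsmul_eq_mul] at h2
  have h3 := mul_le_mul_of_nonneg_right h0 (Nat.cast_nonneg (α := ℝ) T)
  simp only [Nat.succ_eq_add_one] at hC ⊢
  push_cast
  linarith

theorem movementRegret_le_two_mul (hdiam : ∀ i j : K, dist i j ≤ 1) (A : BanditAlgorithm K)
    {ℓ : ℕ → K → ℝ} {T : ℕ} (hℓ : ∀ t < T, ∀ i : K, ℓ t i ∈ Set.Icc (0 : ℝ) 1) :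
    movementRegret A ℓ T ≤ 2 * T := by
  have hcost : ∀ i : Fin T → K, totalCost ℓ i ≤ 2 * T := by
    intro i
    have h1 : ∑ t : Fin T, ℓ t (i t) ≤ T := by
      refine (Finset.sum_le_sum fun (t : Fin T) _ => (hℓ t t.2 (i t)).2).trans_eq ?_
      simp
    have h2 : movementCost i ≤ T := by
      cases T with
      | zero => simp [movementCost]
      | succ T =>
        refine (Finset.sum_le_sum fun t _ => hdiam _ _).trans ?_
        simp
    unfold totalCost
    linarith
  have hinf : 0 ≤ ⨅ i : K, ∑ t ∈ Finset.range T, ℓ t i :=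
    le_ciInf fun i => Finset.sum_nonneg fun t ht => (hℓ t (Finset.mem_range.1 ht) i).1
  have hsum : ∑ i : Fin T → K, (A.actionLaw ℓ T i).toReal * totalCost ℓ i ≤ 2 * T := by
    refine (Finset.sum_le_sum fun i _ =>
      mul_le_mul_of_nonneg_left (hcost i) ENNReal.toReal_nonneg).trans_eq ?_
    rw [← Finset.sum_mul, PMF.sum_toReal_eq_one, one_mul]
  unfold movementRegret
  linarith

end UpperBound

/-- The choice of the depth `H` that balances movement and estimation. -/
theorem exists_depth {c k T : ℝ} (hc : 1 / 2 ≤ c) (hk : 1 ≤ k) (hcT : c ≤ T) (hT : 1 ≤ T) :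
    ∃ H : ℕ, 0 < H ∧ (H : ℝ) ≤ 2 * (1 + Real.log (k * T)) ∧
      T / 2 ^ H ≤ c ^ (1 / 3 : ℝ) * T ^ (2 / 3 : ℝ) ∧
      c * 2 ^ H * T ≤ 2 * (c ^ (1 / 3 : ℝ) * T ^ (2 / 3 : ℝ)) ^ 2 := by
  have hc0 : 0 < c := by linarith
  have hT0 : 0 < T := by linarith
  obtain ⟨a, ha⟩ : ∃ a, a = c ^ (1 / 3 : ℝ) := ⟨_, rfl⟩
  obtain ⟨b, hb⟩ : ∃ b, b = T ^ (1 / 3 : ℝ) := ⟨_, rfl⟩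
  have ha0 : 0 < a := by rw [ha]; positivity
  have hb0 : 0 < b := by rw [hb]; positivity
  have ha3 : a ^ 3 = c := by
    rw [ha, ← Real.rpow_natCast, ← Real.rpow_mul hc0.le]; norm_num
  have hb3 : b ^ 3 = T := by
    rw [hb, ← Real.rpow_natCast, ← Real.rpow_mul hT0.le]; norm_num
  have hb2 : T ^ (2 / 3 : ℝ) = b ^ 2 := by
    rw [hb, ← Real.rpow_natCast, ← Real.rpow_mul hT0.le]; norm_num
  have hab : a ≤ b := by
    rw [ha, hb]; exact Real.rpow_le_rpow hc0.le hcT (by norm_num)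
  -- `2 ^ n` is the power of two just below `(T / c) ^ (1 / 3)`; taking `H = n + 1` makes `2 ^ H`
  -- exceed it, at the price of the factor `2` in the estimation term.
  obtain ⟨n, hn1, hn2⟩ := exists_nat_pow_near ((one_le_div ha0).2 hab) one_lt_two
  refine ⟨n + 1, Nat.succ_pos n, ?_, ?_, ?_⟩
  · have hkT : 1 ≤ k * T := by nlinarith
    have h8 : (8 : ℝ) ^ n ≤ 2 * (k * T) := by
      calc (8 : ℝ) ^ n = (2 ^ n) ^ 3 := by rw [← pow_mul, mul_comm, pow_mul]; norm_num
        _ ≤ (b / a) ^ 3 := pow_le_pow_left₀ (by positivity) hn1 3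
        _ = T / c := by rw [div_pow, ha3, hb3]
        _ ≤ 2 * T := by rw [div_le_iff₀ hc0]; nlinarith
        _ ≤ 2 * (k * T) := by nlinarith
    have hlog := Real.log_le_log (by positivity) h8
    rw [Real.log_pow, Real.log_mul two_ne_zero (by linarith)] at hlog
    have hl2 : Real.log 2 ≤ 1 := by linarith [Real.log_two_lt_d9]
    have hl8 : 1 ≤ Real.log 8 := by
      rw [show (8 : ℝ) = 2 ^ 3 by norm_num, Real.log_pow]
      push_cast
      linarith [Real.log_two_gt_d9]
    have hlk := Real.log_nonneg hkT
    push_cast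
    nlinarith [mul_le_mul_of_nonneg_left hl8 (Nat.cast_nonneg (α := ℝ) n)]
  · rw [← ha, hb2, div_le_iff₀ (by positivity)]
    rw [div_lt_iff₀ ha0] at hn2
    calc T = b ^ 2 * b := by rw [← hb3]; ring
      _ ≤ b ^ 2 * (2 ^ (n + 1) * a) := mul_le_mul_of_nonneg_left hn2.le (by positivity)
      _ = _ := by ring
  · rw [← ha, hb2]
    rw [le_div_iff₀ ha0] at hn1
    calc c * 2 ^ (n + 1) * T = 2 * (a ^ 2 * b ^ 3) * (2 ^ n * a) := by
          rw [← ha3, ← hb3]; ring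
      _ ≤ 2 * (a ^ 2 * b ^ 3) * b := mul_le_mul_of_nonneg_left hn1 (by positivity)
      _ = _ := by ring

theorem theorem1 :
    ∃ (C : ℝ) (p : ℕ), 0 < C ∧
      ∀ (K : Type u) [MetricSpace K] [Fintype K] [Nonempty K],
        (∀ i j : K, dist i j ≤ 1) →
        ∀ T : ℕ, ∃ A : BanditAlgorithm K,
          ∀ ℓ : ℕ → K → ℝ, (∀ t < T, ∀ i : K, ℓ t i ∈ Set.Icc (0 : ℝ) 1) →
            movementRegret A ℓ T ≤
              C * (1 + Real.log ((Fintype.card K : ℝ) * T)) ^ p *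
                max ((coveringComplexity K).toReal ^ (1 / 3 : ℝ) * (T : ℝ) ^ (2 / 3 : ℝ))
                  (Real.sqrt ((Fintype.card K : ℝ) * T)) := by
  refine ⟨20, 1, by norm_num, fun K _ _ _ hdiam T => ?_⟩
  have hk : (1 : ℝ) ≤ Fintype.card K := by exact_mod_cast Fintype.card_pos
  have hc := half_le_coveringComplexity (K := K)
  have hck := coveringComplexity_toReal_le_card (K := K)
  set k : ℝ := ((Fintype.card K : ℕ) : ℝ) with hk_def
  set c : ℝ := (coveringComplexity K).toReal with hc_def
  set M : ℝ := max (c ^ (1 / 3 : ℝ) * (T : ℝ) ^ (2 / 3 : ℝ)) (Real.sqrt (k * T)) with hM_def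
  have hM0 : Real.sqrt (k * T) ≤ M := le_max_right _ _
  have hkT : 0 ≤ k * T := by positivity
  have hΛ : 0 ≤ Real.log (k * T) := by
    rcases T.eq_zero_or_pos with rfl | hT
    · simp
    · have : (1 : ℝ) ≤ T := by exact_mod_cast hT
      exact Real.log_nonneg (by nlinarith)
  rw [pow_one]
  by_cases hcT : c ≤ T
  · have hT : (1 : ℝ) ≤ T := by
      have h0 : (0 : ℝ) < T := by linarith
      exact_mod_cast Nat.cast_pos.1 h0
    obtain ⟨H, hH, hHΛ, hmove, hest⟩ := exists_depth hc hk hcT hT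
    have hMpos : 0 < M := (Real.sqrt_pos.2 (by positivity)).trans_le hM0
    have hMm : c ^ (1 / 3 : ℝ) * (T : ℝ) ^ (2 / 3 : ℝ) ≤ M := le_max_left _ _
    -- With `η = 1 / M`, both `k T` and `c 2 ^ H T` are `O(M ^ 2)`, so each term of the regret is
    -- `O(M)` up to one logarithm. The coefficients total `18.5` for `M` and `19` for `log (k T) *
    -- M`, within `20`.
    obtain ⟨A, hA⟩ := exists_movementRegret_le hdiam hH (inv_pos.2 hMpos) T
    refine ⟨A, fun ℓ hℓ => (hA ℓ hℓ).trans ?_⟩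
    rw [← hk_def, ← hc_def, div_inv_eq_mul]
    have hlogk : Real.log k ≤ Real.log (k * T) :=
      Real.log_le_log (by linarith) (by nlinarith)
    have h1 : k * T ≤ M ^ 2 := by
      rw [← Real.sq_sqrt hkT]
      exact pow_le_pow_left₀ (Real.sqrt_nonneg _) hM0 2
    have h2 : c * 2 ^ H * T ≤ 2 * M ^ 2 :=
      hest.trans (mul_le_mul_of_nonneg_left (pow_le_pow_left₀ (by positivity) hMm 2) two_pos.le)
    have h3 : H * (c * 2 ^ H * T) ≤ 2 * (1 + Real.log (k * T)) * (2 * M ^ 2) :=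
      mul_le_mul hHΛ h2 (by positivity) (by positivity)
    have h4 : M⁻¹ / 2 * (k * T + H * (c * 2 ^ H * T))
        ≤ M⁻¹ / 2 * (M ^ 2 + 2 * (1 + Real.log (k * T)) * (2 * M ^ 2)) :=
      mul_le_mul_of_nonneg_left (add_le_add h1 h3) (by positivity)
    have h5 : M⁻¹ / 2 * (M ^ 2 + 2 * (1 + Real.log (k * T)) * (2 * M ^ 2))
        = M / 2 + 2 * (1 + Real.log (k * T)) * M := by
      field_simp
    have h6 : (8 * H : ℝ) * (T / 2 ^ H) ≤ 8 * (2 * (1 + Real.log (k * T))) * M :=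
      mul_le_mul (by linarith) (hmove.trans hMm) (by positivity) (by positivity)
    have h7 : Real.log k * M ≤ Real.log (k * T) * M := mul_le_mul_of_nonneg_right hlogk hMpos.le
    have h8 : 0 ≤ Real.log (k * T) * M := mul_nonneg hΛ hMpos.le
    linarith
  -- Here `T < c ≤ k`, so `T ≤ √(k T)` and the trivial bound `2 T` suffices for any learner; this
  -- case includes `T = 0`.
  · obtain ⟨A, -⟩ := exists_movementRegret_le hdiam one_pos one_pos T
    refine ⟨A, fun ℓ hℓ => (movementRegret_le_two_mul hdiam A hℓ).trans ?_⟩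
    have hT0 : (0 : ℝ) ≤ T := Nat.cast_nonneg T
    have h1 : (T : ℝ) ≤ M := by
      refine le_trans (Real.le_sqrt_of_sq_le ?_) hM0
      nlinarith
    have h2 : 0 ≤ Real.log (k * T) * M := mul_nonneg hΛ (hT0.trans h1)
    linarith
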